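/- **Setting.** Let $I_1,I_2,I_3\subset\mathbb Z$ be finite, $\mathcal I=I_1\times I_2\times I_3$, and $E:\mathcal I\to\mathbb R\setminus\{0\}$. Consider the rank-3 quartic melonic tensor model with action $\sum_{\mathbf x\in\mathcal I}\bar\phi_{\mathbf x}E_{\mathbf x}\phi_{\mathbf x}+\lambda\sum_{i=1}^3\mathrm{Tr}_{V_i}(\phi,\bar\phi)$ and sources $J_{\mathbf x},\bar J_{\mathbf x}$ ($\mathbf x\in\mathcal I$), all expressions being formal power series in $\lambda$ and in the sources. *Graphs.* A closed 3-coloured graph $\mathcal B$, possibly disconnected, with ordered white and black vertices $1,\dots,k$, is a triple of permutations $(\tau_1,\tau_2,\tau_3)$ of $\{1,\dots,k\}$: the edge of colour $c$ at the white vertex $\mu$ ends at the black vertex $\tau_c(\mu)$. An automorphism is a pair of permutations of the white and of the black vertices preserving all coloured edges; $|\mathrm{Aut}_{\mathrm c}(\mathcal B)|$ is the number of automorphisms. For $\mathbf X=(\mathbf x^1,\dots,\mathbf x^k)\in\mathcal I^k$ put $\mathbb J(\mathcal B)(\mathbf X)=\prod_\mu J_{\mathbf x^\mu}\prod_\beta\bar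 J_{\mathbf y^\beta}$ with $y^\beta_c=x_c^{\tau_c^{-1}(\beta)}$, and $f\star\mathbb J(\mathcal B)=\sum_{\mathbf X\in\mathcal I^k}f(\mathbf X)\,\mathbb J(\mathcal B)(\mathbf X)$ for a function $f$ of $k$ momenta. For $\sigma\in\mathfrak S_k$ let $(\sigma^*f)(\mathbf x^1,\dots,\mathbf x^k)=f(\mathbf x^{\sigma^{-1}(1)},\dots,\mathbf x^{\sigma^{-1}(k)})$; so $((132)^*f)(\mathbf x,\mathbf y,\mathbf z)=f(\mathbf y,\mathbf z,\mathbf x)$. *Correlation functions.* An open Feynman graph has $n$ interaction vertices, each a copy of some $V_i$ (two white and two black vertices; the two edges of colour $i$ join equally labelled ones and those of the two other colours join differently labelled ones), $k$ univalent white vertices (for $J$) and $k$ univalent black vertices (for $\bar J$), and edges of colour $0$ (propagators) matching all white with all black vertices. Its boundary graph has as white (black) vertices the $J$-legs ($\bar J$-legs) and as edges of colour $c$ the paths of alternating colours $0,c$ between external legs. $G^{(2k)}_{\mathcal B}(\mathbf X)$ is the sum, over all connected labelled Feynman graphs with ordered external legs and boundary graph $\mathcal B$, of $\frac{(-\lambda)^n}{n!}$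 times the sum over internal momenta of the product of all propagators $1/E$ (external ones included), where each propagator carries a momentum in $\mathcal I$, the components of colour $c$ agree along the edges of colour $c$, and the propagator at the $\mu$-th $J$-leg carries $\mathbf x^\mu$. The boundary sector is the set of boundary graphs of connected Feynman graphs of the model. *Edge removal.* $\mathcal B\ominus e_a^r$ is obtained by removing the $r$-th white vertex and the black vertex $\tau_a(r)$ together with all edges joining them, and gluing the broken edges colourwise; the other vertices keep their order. For $s_a\in I_a$, $(\Delta_{s_a,r}G_{\mathcal B})(\mathbf y^1,\dots,\mathbf y^{k-1})=\sum G_{\mathcal B}(\mathbf y^1,\dots,\mathbf y^{r-1},\mathbf z,\mathbf y^r,\dots,\mathbf y^{k-1})$, where $z_a=s_a$; $z_i$ is the $i$-th momentum component of the white vertex $\tau_i^{-1}(\tau_a(r))$ if this is not $r$; and all other components of $\mathbf z$ are summed over. Finally $$Y^{(a)}_{s_a}[J,\bar J]=\sum_{l\ge1}\ \sum_{\mathcal B}\frac1{|\mathrm{Aut}_{\mathrm c}(\mathcal B)|}\sum_{r=1}^{l}\big(\Delta_{s_a,r}G^{(2l)}_{\mathcal B}\big)\star\mathbb J(\mathcal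 B\ominus e_a^r),$$ the inner sum running over the isomorphism classes of graphs with $l$ white vertices in the boundary sector. *Graphs with at most 8 vertices.* Write permutations as words $\tau(1)\tau(2)\cdots$. Let $\{i,j,l\}=\{1,2,3\}$. $m$ is the melon ($k=1$), $\emptyset$ the empty graph. In the following graphs $\tau_i=\mathrm{id}$ and both other permutations are equal to: $21$ for $V_i$; $312$ for $Q_i$; $4123$ for $A_i$. In the remaining ones $\tau_i=\mathrm{id}$ and $(\tau_j,\tau_l)$ is $E_{ij}:(213,132)$; $K_{ij}:(312,231)$; $W_{ij}:(3124,1342)$; $R_{ij}:(1324,2143)$; $P_{ij}:(2134,1342)$; $S_{ij}:(2314,2431)$; $C_{ij}:(3412,2143)$; $X^0_{ij}:(4123,2413)$; $X_{ij}:(2413,2341)$; $Y^0_{ij}:(4123,2341)$; $Y_{ij}:(3142,2413)$. Let $\{a,b,c\}=\{1,2,3\}$ and abbreviate $E_a=E_{ab}$, $E_b=E_{ba}$, $E_c=E_{ca}$, $K=K_{ab}$, $W_a=W_{ab}$, $W_b=W_{bc}$, $W_c=W_{ca}$, $S=S_{ab}$, $C=C_{ab}$, $X_a=X^0_{ab}$,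 $X_b=X_{bc}$, $X_c=X_{cb}$, $Y_a=Y^0_{ab}$, $Y_b=Y_{bc}$, $Y_c=Y_{cb}$. Juxtaposition of graphs means disjoint union (vertices of the left graph first), and $\Delta_r\mathcal B$ stands for $\Delta_{s_a,r}G_{\mathcal B}$. **Lemma.** For every $s_a\in I_a$, up to terms of order at least $8$ in the sources, $Y^{(a)}_{s_a}[J,\bar J]$ equals the sum of the following terms ($\Delta_1 m=\sum_{q_b,q_c}G^{(2)}_m(s_a,q_b,q_c)$ in the first one): 1. $\Delta_1 m\star\mathbb J(\emptyset)$ 2. $\frac12\sum_{r=1}^2\big(\Delta_r mm+\Delta_rV_a+\Delta_rV_b+\Delta_rV_c\big)\star\mathbb J(m)$ 3. $\big(\frac13\sum_{r=1}^3(\Delta_rQ_a+\Delta_rK)+\Delta_3E_b+\Delta_3E_c+\frac12\Delta_1mV_a\big)\star\mathbb J(V_a)$ 4. $\big(\frac13\sum_{r=1}^3\Delta_rQ_b+\Delta_3E_a+\sum_{r=1,2}\Delta_rE_c+\frac12\Delta_1mV_b\big)\star\mathbb J(V_b)$ 5. $\big(\frac13\sum_{r=1}^3\Delta_rQ_c+\Delta_1E_a+\sum_{r=1,2}\Delta_rE_b+\frac12\Delta_1mV_c\big)\star\mathbb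 J(V_c)$ 6. $\big(\frac1{3!}\sum_{r=1}^3\Delta_rmmm+\Delta_2E_a+\frac12\sum_{r=2,3}\sum_{i=1}^3\Delta_rmV_i\big)\star\mathbb J(mm)$ 7. $\big(\frac14\sum_{r=3,4}\sum_{i=1}^3\Delta_rmmV_i+\frac1{4!}\sum_{r=1}^4\Delta_rmmmm+\Delta_3mE_a\big)\star\mathbb J(mmm)$ 8. $\big(\frac18\sum_{r=1,2}\Delta_rV_aV_a+\frac18\sum_{r=3,4}(132)^*\Delta_rV_aV_a+\frac14\sum_{r=1,2}(\Delta_rV_bV_a+\Delta_rV_cV_a)+\frac13\sum_{r=2}^4(\Delta_rmK+\Delta_rmQ_a)+\Delta_4mE_c+\Delta_4mE_b+\frac14\sum_{r=1,2}\Delta_rmmV_a+\Delta_2W_b+(132)^*\Delta_3W_c\big)\star\mathbb J(mV_a)$ 9. $\big(\frac18\sum_{r=1,2}\Delta_rV_bV_b+\frac18\sum_{r=3,4}(132)^*\Delta_rV_bV_b+\frac14\sum_{r=3,4}(132)^*(\Delta_rV_bV_a+\Delta_rV_bV_c)+\frac13\sum_{r=2}^4\Delta_rmQ_b+\sum_{r=2,3}\Delta_rmE_c+\Delta_4mE_a+\frac14\sum_{r=1,2}\Delta_rmmV_b+\frac12\Delta_2R_{ac}+\frac12(132)^*\Delta_3R_{ac}+\Delta_2P_{ac}\big)\star\mathbb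 J(mV_b)$ 10. $\big(\frac18\sum_{r=1,2}\Delta_rV_cV_c+\frac18\sum_{r=3,4}(132)^*\Delta_rV_cV_c+\frac14\sum_{r=3,4}(132)^*\Delta_rV_cV_a+\frac14\sum_{r=1,2}\Delta_rV_bV_c+\frac13\sum_{r=2}^4\Delta_rmQ_c+\sum_{r=2,3}\Delta_rmE_b+\Delta_2mE_a+\frac14\sum_{r=1,2}\Delta_rmmV_c+\frac12\Delta_2R_{ab}+\frac12(132)^*\Delta_3R_{ab}+\Delta_2P_{ab}\big)\star\mathbb J(mV_c)$ 11. $\big(\frac13\Delta_1mK+\Delta_1X_b+(13)^*\Delta_1X_c+\sum_{r=3,4}\Delta_rX_a+\frac14\sum_{r=1}^4\Delta_rY_a\big)\star\mathbb J(K)$ 12. $\big(\frac13\Delta_1mQ_a+\Delta_1P_{bc}+\Delta_1P_{cb}+\frac14\sum_{r=1}^4\Delta_rA_a+\sum_{r=1,2}\Delta_rX_a\big)\star\mathbb J(Q_a)$ 13. $\big(\frac13\Delta_1mQ_b+\frac12\Delta_2R_{ca}+\frac12(13)^*\Delta_3R_{ca}+\frac14\sum_{r=1}^4\Delta_rA_b+\Delta_1P_{ac}+\sum_{r=1,2}\Delta_rP_{ca}\big)\star\mathbb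 J(Q_b)$ 14. $\big(\frac13\Delta_1mQ_c+\frac12\Delta_2R_{ba}+\frac12(13)^*\Delta_3R_{ba}+\frac14\sum_{r=1}^4\Delta_rA_c+\Delta_1P_{ab}+\sum_{r=1,2}\Delta_rP_{ba}\big)\star\mathbb J(Q_c)$ 15. $\big(\Delta_1mE_a+\sum_{r=2,3}\Delta_rW_a+\sum_{r=3,4}(13)^*\Delta_rW_b+\sum_{r=3,4}(\Delta_rP_{ab}+(13)^*\Delta_rP_{ac})+\sum_{r=1,2}(13)^*\Delta_rW_c+\frac12(\Delta_1R_{ab}+(13)^*\Delta_1R_{ac}+(13)^*\Delta_4R_{ab}+\Delta_4R_{ac})+\sum_{r=1,2}(12)^*\Delta_rS+\frac14((23)^*\Delta_1C+\Delta_2C+(13)^*\Delta_3C+(132)^*\Delta_4C)\big)\star\mathbb J(E_a)$ 16. $\big(\Delta_1mE_b+\Delta_1W_a+\Delta_4W_c+\frac12(\sum_{r=1,2}(13)^*\Delta_rR_{bc}+\sum_{r=3,4}\Delta_rR_{bc}+\Delta_1R_{ba}+(13)^*\Delta_4R_{ba})+\sum_{r=3,4}\Delta_rP_{ba}+\sum_{r=2}^4(13)^*(\Delta_rP_{bc}+\Delta_rX_c)+\Delta_3S+\frac14(\Delta_1Y_c+(132)^*\Delta_2Y_c+(23)^*\Delta_3Y_c+(13)^*\Delta_4Y_c)\big)\star\mathbb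 J(E_b)$ 17. $\big(\Delta_1mE_c+(13)^*\Delta_4W_a+(13)^*\Delta_1W_b+\frac12(\sum_{r=1,2}(13)^*\Delta_rR_{cb}+\sum_{r=3,4}\Delta_rR_{cb}+\Delta_1R_{ca}+(13)^*\Delta_4R_{ca})+\sum_{r=3,4}\Delta_rP_{ca}+\sum_{r=2}^4(13)^*(\Delta_rP_{cb}+\Delta_rX_b)+\Delta_4S+\frac14(\Delta_1Y_b+(132)^*\Delta_2Y_b+(23)^*\Delta_3Y_b+(13)^*\Delta_4Y_b)\big)\star\mathbb J(E_c)$ -/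

import Mathlib

open scoped PowerSeries

noncomputable section

namespace TensorModel

/-! ### Closed (possibly disconnected) 3-coloured graphs with ordered vertices -/

/-- A closed regularly edge-3-coloured bipartite graph, possibly disconnected, with `k` white and
`k` black vertices, both ordered: `B c μ` is the black vertex that the edge of colour `c` starting
at the white vertex `μ` ends at. -/
abbrev ColGraph (k : ℕ) : Type := Fin 3 → Equiv.Perm (Fin k)

/-- Isomorphisms of coloured graphs are pairs of bijections of the white and of the black vertices
that preserve all the coloured edges. -/
def isoSetoid (k : ℕ) : Setoid (ColGraph k) where
  r B B' := ∃ π ρ : Equiv.Perm (Fin k), ∀ c μ, B' c (π μ) = ρ (B c μ)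
  iseqv :=
    { refl := fun B => ⟨1, 1, fun _ _ => rfl⟩
      symm := by
        rintro B B' ⟨π, ρ, h⟩
        refine ⟨π.symm, ρ.symm, fun c μ => ?_⟩
        rw [Equiv.eq_symm_apply, ← h, Equiv.apply_symm_apply]
      trans := by
        rintro B B' B'' ⟨π, ρ, h⟩ ⟨π', ρ', h'⟩
        refine ⟨π' * π, ρ' * ρ, fun c μ => ?_⟩
        simp [Equiv.Perm.mul_apply, h, h'] }

/-- The order of the group of coloured automorphisms of `B`. -/
def autCard {k : ℕ} (B : ColGraph k) : ℕ :=
  Nat.card {p : Equiv.Perm (Fin k) × Equiv.Perm (Fin k) // ∀ c μ, B c (p.1 μ) = p.2 (B c μ)}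

/-- Disjoint union; the vertices of the first graph come first. -/
def disj {k l : ℕ} (B : ColGraph k) (C : ColGraph l) : ColGraph (k + l) :=
  fun c => finSumFinEquiv.permCongr (Equiv.sumCongr (B c) (C c))

/-- The graph `B ⊖ e_a^r`: both ends of the edge of colour `a` at the white vertex `r` are removed,
together with all the edges joining them, and the broken edges are glued colourwise. The other
vertices keep their order. -/
def remove {k : ℕ} (B : ColGraph (k + 1)) (a : Fin 3) (r : Fin (k + 1)) : ColGraph k := fun c =>
  let σ : Equiv.Perm (Fin (k + 1)) := (B c).trans (Equiv.swap (B a r) (B c r))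
  have hσ : ∀ x, x ≠ r ↔ σ x ≠ B a r := fun x => by
    rw [← show σ r = B a r by simp [σ]]
    exact σ.injective.ne_iff.symm
  (finSuccAboveEquiv r).trans ((σ.subtypeEquiv hσ).trans (finSuccAboveEquiv (B a r)).symm)

/-! ### Momenta, sources and the pairing -/

/-- Momenta of the lattice `I 0 × I 1 × I 2`. -/
abbrev Mom (I : Fin 3 → Finset ℤ) : Type := ∀ c, I c

/-- Functionals of the sources: formal power series in the variables `J_x` (left) and `J̄_x`
(right), whose coefficients are formal power series in the coupling constant. -/
abbrev SourceSeries (I : Fin 3 → Finset ℤ) : Type := MvPowerSeries (Mom I ⊕ Mom I) ℂ⟦X⟧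

/-- The source cycle `𝕁(B)(X)`. -/
def cycle {I : Fin 3 → Finset ℤ} {k : ℕ} (B : ColGraph k) (X : Fin k → Mom I) : SourceSeries I :=
  (∏ μ, MvPowerSeries.X (Sum.inl (X μ))) *
    ∏ β, MvPowerSeries.X (Sum.inr fun c => X ((B c).symm β) c)

/-- Functions of `k` momenta with values in the formal power series in the coupling constant. -/
abbrev MomFun (I : Fin 3 → Finset ℤ) (k : ℕ) : Type := (Fin k → Mom I) → ℂ⟦X⟧

/-- The pairing `f ⋆ 𝕁(B)`. -/
def srcPair {I : Fin 3 → Finset ℤ} {k : ℕ} (f : MomFun I k) (B : ColGraph k) : SourceSeries I :=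
  ∑ X : Fin k → Mom I, f X • cycle B X

/-- The pull-back `σ^* f`. -/
def permStar {I : Fin 3 → Finset ℤ} {k : ℕ} (σ : Equiv.Perm (Fin k)) (f : MomFun I k) :
    MomFun I k :=
  fun X => f fun μ => X (σ.symm μ)

open Classical in
/-- The function `Δ_{s_a,r}^B F`. The momentum `z` inserted at place `r` has the component `s` in
colour `a`; if the edge of colour `i` ending at the black vertex `B a r` starts at another white
vertex, its component of colour `i` is that of this vertex; the remaining components, those of the
colours other than `a` of edges joining `r` to `B a r`, are summed over. -/
def Delta {I : Fin 3 → Finset ℤ} {k : ℕ} (B : ColGraph (k + 1)) (a : Fin 3) (s : I a)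
    (r : Fin (k + 1)) (F : MomFun I (k + 1)) : MomFun I k := fun Y =>
  ∑ z : Mom I with z a = s ∧ ∀ i κ, B i (r.succAbove κ) = B a r → z i = Y κ i,
    F (r.insertNth (α := fun _ => Mom I) z Y)

/-- The pairing `⟪F, B⟫_{s_a}`. -/
def pairing {I : Fin 3 → Finset ℤ} {k : ℕ} (a : Fin 3) (s : I a) (F : MomFun I (k + 1))
    (B : ColGraph (k + 1)) : SourceSeries I :=
  ∑ r, srcPair (Delta B a s r F) (remove B a r)

/-! ### Feynman graphs of the quartic melonic model and correlation functions -/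

/-- White (and likewise black) vertices of a Feynman graph with `n` quartic interaction vertices
and `2 k` external legs: two of them in each interaction vertex, and the `k` univalent vertices
at the ends of the external legs (white for a source `J`, black for a source `J̄`). -/
abbrev FVert (n k : ℕ) : Type := (Fin n × Fin 2) ⊕ Fin k

/-- Labelled open Feynman graphs: the colour of each interaction vertex, and the edges of
colour 0 (the propagators), which match the white with the black vertices. -/
abbrev FeynGraph (n k : ℕ) : Type := (Fin n → Fin 3) × (FVert n k ≃ FVert n k)

/-- The white vertex that is joined by the edge of colour `c` to the black vertex `b` of an
interaction vertex. In the interaction vertex of colour `i`, the edges of colour `i` join equally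
labelled vertices, and those of both other colours join differently labelled ones. -/
def FeynGraph.nbr {n k : ℕ} (G : FeynGraph n k) (c : Fin 3) (b : Fin n × Fin 2) : Fin n × Fin 2 :=
  (b.1, if c = G.1 b.1 then b.2 else Equiv.swap 0 1 b.2)

/-- Adjacency, by an edge of colour 0, 1, 2 or 3, of a white and a black vertex. -/
def FeynGraph.Joined {n k : ℕ} (G : FeynGraph n k) (u v : FVert n k) : Prop :=
  G.2 u = v ∨ ∃ c b, v = Sum.inl b ∧ u = Sum.inl (G.nbr c b)

/-- Connectedness of a Feynman graph. -/
def FeynGraph.IsConnected {n k : ℕ} (G : FeynGraph n k) : Prop :=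
  (SimpleGraph.fromRel fun x y : FVert n k ⊕ FVert n k =>
    ∃ u v, x = Sum.inl u ∧ y = Sum.inr v ∧ G.Joined u v).Connected

/-- There is a path with colours alternating between 0 and `c`, starting with the edge of colour 0
at the white vertex `u` and ending at the external black vertex `β`. -/
inductive FeynGraph.Path {n k : ℕ} (G : FeynGraph n k) (c : Fin 3) : FVert n k → Fin k → Prop
  | last (u : FVert n k) (β : Fin k) : G.2 u = Sum.inr β → FeynGraph.Path G c u β
  | step (u : FVert n k) (b : Fin n × Fin 2) (β : Fin k) : G.2 u = Sum.inl b →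
      FeynGraph.Path G c (Sum.inl (G.nbr c b)) β → FeynGraph.Path G c u β

/-- `B` is the boundary graph of `G`: its vertices are the external legs, and its edges of colour
`c` are the paths in `G` of alternating colours 0 and `c` between external legs. -/
def FeynGraph.IsBoundary {n k : ℕ} (G : FeynGraph n k) (B : ColGraph k) : Prop :=
  ∀ c j, G.Path c (Sum.inr j) (B c j)

open Classical in
/-- The amplitude of a Feynman graph at momenta `X` of the `J`-legs. A momentum is assigned to each
propagator (indexed by its white end) so that the components of colour `c` agree along the edges of
colour `c` of the interaction vertices; the product of all the propagators `1 / E`, those at the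
external legs included, is summed over the internal momenta. -/
def FeynGraph.amplitude {I : Fin 3 → Finset ℤ} {n k : ℕ} (E : Mom I → ℝ) (G : FeynGraph n k)
    (X : Fin k → Mom I) : ℂ :=
  ∑ p : FVert n k → Mom I with (∀ j, p (Sum.inr j) = X j) ∧
      ∀ u b, G.2 u = Sum.inl b → ∀ c, p u c = p (Sum.inl (G.nbr c b)) c,
    ∏ u, ((E (p u) : ℂ))⁻¹

open Classical in
/-- The connected correlation function `G_B^{(2k)}` of the model with action
`Tr₂(φ̄, E φ) + λ (Tr_{V_1} + Tr_{V_2} + Tr_{V_3})`, as a formal power series in `λ`: the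
sum over the connected Feynman graphs with boundary graph `B`. -/
def corr {I : Fin 3 → Finset ℤ} (E : Mom I → ℝ) {k : ℕ} (B : ColGraph k) : MomFun I k := fun X =>
  PowerSeries.mk fun n => ((-1) ^ n / (n.factorial : ℂ)) *
    ∑ G : FeynGraph n k with G.IsConnected ∧ G.IsBoundary B, G.amplitude E X

/-- The boundary sector of the model: the boundary graphs of its connected Feynman graphs. -/
def boundarySector (k : ℕ) : Set (ColGraph k) :=
  {B | ∃ (n : ℕ) (G : FeynGraph n k), G.IsConnected ∧ G.IsBoundary B}

open Classical in
/-- The part of `Y^{(a)}_{s_a}` coming from the boundary graphs with `l + 1` white vertices, up to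
isomorphism. It is homogeneous of degree `2 l` in the sources. The ordering of the
vertices of the chosen representatives does not matter. -/
def Yterm {I : Fin 3 → Finset ℤ} (E : Mom I → ℝ) (a : Fin 3) (s : I a) (l : ℕ) : SourceSeries I :=
  ∑ q : Quotient (isoSetoid (l + 1)),
    if q.out ∈ boundarySector (l + 1) then
      ((autCard q.out : ℂ)⁻¹) • pairing a s (corr E q.out) q.out
    else 0

/-- The functional `Y^{(a)}_{s_a}[J, J̄]` of the Ward-Takahashi identity, the sum of all the
`Yterm E a s l`; since these are homogeneous of degree `2 l`, a coefficient of total degree `d`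
only gets contributions from `l ≤ d`. -/
def Y {I : Fin 3 → Finset ℤ} (E : Mom I → ℝ) (a : Fin 3) (s : I a) : SourceSeries I := fun m =>
  ∑ l ∈ Finset.range (m.degree + 1), MvPowerSeries.coeff m (Yterm E a s l)

/-- `Δ_{s_a,r} G_B`, with `r` counted from 0. -/
def D {I : Fin 3 → Finset ℤ} (E : Mom I → ℝ) {a : Fin 3} (s : I a) {k : ℕ} (r : Fin (k + 1))
    (B : ColGraph (k + 1)) : MomFun I k :=
  Delta B a s r (corr E B)

/-! ### The graphs with at most 8 vertices

In `tri i j β γ`, the edge of colour `i` joins the white vertex `μ` to the black vertex `μ`, that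
of colour `j` joins it to `β μ`, and that of the remaining colour joins it to `γ μ`. -/

/-- Graph given by its edges of colour `i`, `j` and of the third colour. -/
def tri {k : ℕ} (i j : Fin 3) (β γ : Equiv.Perm (Fin k)) : ColGraph k :=
  fun c => if c = i then 1 else if c = j then β else γ

/-- Graph in which the edges of the two colours other than `i` are parallel. -/
def dbl {k : ℕ} (i : Fin 3) (β : Equiv.Perm (Fin k)) : ColGraph k := tri i i 1 β

/-- The empty graph. -/
def gEmpty : ColGraph 0 := fun _ => 1

/-- The melon: two vertices, joined by three edges. -/
def gm : ColGraph 1 := fun _ => 1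

/-- `V_i`: the pillow graph with 4 vertices. -/
def gV (i : Fin 3) : ColGraph 2 := dbl i ⟨![1, 0], ![1, 0], by decide, by decide⟩

/-- `Q_i`: the cyclic graph with 6 vertices and three double edges. -/
def gQ (i : Fin 3) : ColGraph 3 := dbl i ⟨![2, 0, 1], ![1, 2, 0], by decide, by decide⟩

/-- `E_{ijl}`: the graph with 6 vertices and two double edges. -/
def gE (i j : Fin 3) : ColGraph 3 :=
  tri i j ⟨![1, 0, 2], ![1, 0, 2], by decide, by decide⟩
    ⟨![0, 2, 1], ![0, 2, 1], by decide, by decide⟩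

/-- The coloured complete bipartite graph `K(3,3)`. -/
def gK (i j : Fin 3) : ColGraph 3 :=
  tri i j ⟨![2, 0, 1], ![1, 2, 0], by decide, by decide⟩
    ⟨![1, 2, 0], ![2, 0, 1], by decide, by decide⟩

/-- `A_i`: the cyclic graph with 8 vertices and four double edges. -/
def gA (i : Fin 3) : ColGraph 4 := dbl i ⟨![3, 0, 1, 2], ![1, 2, 3, 0], by decide, by decide⟩

/-- `W_i`. -/
def gW (i j : Fin 3) : ColGraph 4 :=
  tri i j ⟨![2, 0, 1, 3], ![1, 2, 0, 3], by decide, by decide⟩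
    ⟨![0, 2, 3, 1], ![0, 3, 1, 2], by decide, by decide⟩

/-- `R_{ij}`. -/
def gR (i j : Fin 3) : ColGraph 4 :=
  tri i j ⟨![0, 2, 1, 3], ![0, 2, 1, 3], by decide, by decide⟩
    ⟨![1, 0, 3, 2], ![1, 0, 3, 2], by decide, by decide⟩

/-- `P_{ij}`. -/
def gP (i j : Fin 3) : ColGraph 4 :=
  tri i j ⟨![1, 0, 2, 3], ![1, 0, 2, 3], by decide, by decide⟩
    ⟨![0, 2, 3, 1], ![0, 3, 1, 2], by decide, by decide⟩

/-- `S`. -/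
def gS (i j : Fin 3) : ColGraph 4 :=
  tri i j ⟨![1, 2, 0, 3], ![2, 0, 1, 3], by decide, by decide⟩
    ⟨![1, 3, 2, 0], ![3, 0, 2, 1], by decide, by decide⟩

/-- `C`: the coloured cube. -/
def gC (i j : Fin 3) : ColGraph 4 :=
  tri i j ⟨![2, 3, 0, 1], ![2, 3, 0, 1], by decide, by decide⟩
    ⟨![1, 0, 3, 2], ![1, 0, 3, 2], by decide, by decide⟩

/-- `X_a`, where `i = a`. -/
def gXa (i j : Fin 3) : ColGraph 4 :=
  tri i j ⟨![3, 0, 1, 2], ![1, 2, 3, 0], by decide, by decide⟩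
    ⟨![1, 3, 0, 2], ![2, 0, 3, 1], by decide, by decide⟩

/-- `X_i` for `i = b, c`. -/
def gX (i j : Fin 3) : ColGraph 4 :=
  tri i j ⟨![1, 3, 0, 2], ![2, 0, 3, 1], by decide, by decide⟩
    ⟨![1, 2, 3, 0], ![3, 0, 1, 2], by decide, by decide⟩

/-- `Y_a`, where `i = a`. -/
def gYa (i j : Fin 3) : ColGraph 4 :=
  tri i j ⟨![3, 0, 1, 2], ![1, 2, 3, 0], by decide, by decide⟩
    ⟨![1, 2, 3, 0], ![3, 0, 1, 2], by decide, by decide⟩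

/-- `Y_i` for `i = b, c`. -/
def gY (i j : Fin 3) : ColGraph 4 :=
  tri i j ⟨![2, 0, 3, 1], ![1, 3, 0, 2], by decide, by decide⟩
    ⟨![1, 3, 0, 2], ![2, 0, 3, 1], by decide, by decide⟩

/-- `m ⊔ m`, for the melon `m`. -/
def gmm : ColGraph 2 := disj gm gm

/-- `m ⊔ m ⊔ m`. -/
def gmmm : ColGraph 3 := disj gm gmm

/-- `m ⊔ m ⊔ m ⊔ m`. -/
def gmmmm : ColGraph 4 := disj gm gmmm

/-- `m ⊔ V_i`. -/
def gmV (i : Fin 3) : ColGraph 3 := disj gm (gV i)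

/-- `m ⊔ m ⊔ V_i`. -/
def gmmV (i : Fin 3) : ColGraph 4 := disj gm (gmV i)

/-- `V_i ⊔ V_j`. -/
def gVV (i j : Fin 3) : ColGraph 4 := disj (gV i) (gV j)

/-- `m ⊔ Q_i`. -/
def gmQ (i : Fin 3) : ColGraph 4 := disj gm (gQ i)

/-- `m ⊔ E_{ijl}`. -/
def gmE (i j : Fin 3) : ColGraph 4 := disj gm (gE i j)

/-- `m ⊔ K(3,3)`. -/
def gmK (i j : Fin 3) : ColGraph 4 := disj gm (gK i j)

/-- The transposition of the first and the second vertex. -/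
def p12 : Equiv.Perm (Fin 3) := Equiv.swap 0 1

/-- The transposition of the first and the third vertex. -/
def p13 : Equiv.Perm (Fin 3) := Equiv.swap 0 2

/-- The transposition of the second and the third vertex. -/
def p23 : Equiv.Perm (Fin 3) := Equiv.swap 1 2

/-- The 3-cycle `1 ↦ 3 ↦ 2 ↦ 1`, so that `(p132^* f)(x, y, z) = f(y, z, x)`. -/
def p132 : Equiv.Perm (Fin 3) := ⟨![2, 0, 1], ![1, 2, 0], by decide, by decide⟩

end TensorModel

end

open TensorModel

/-!
The part of `Y^{(a)}` of degree `2 l` in the sources is a sum over the isomorphism classes of graphs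
with `l + 1` white vertices, so the theorem amounts to the classification of the graphs with at most
8 vertices, with their automorphisms, and to the identification of the graphs obtained from them by
removing an edge of colour `a`.

*Invariance.* Relabelling the external legs is a bijection between the Feynman graphs with isomorphic
boundary graphs, so `corr E B` depends on the order of the vertices of `B` only through the labels of
the momenta (`corr_comp`). In `Δ_{s,r} F ⋆ 𝕁(B ⊖ e_a^r)`, the momentum inserted at `r` is constrained
to be that of the black vertex `B a r`, so that this pairing is a sum over the momenta of all white
vertices of `B`, subject to this constraint, without the two sources at the ends of the edge
(`srcPair_Delta`). In this form the order of the vertices plays no role, and every isomorphism class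
may be represented by any of its members (`pairing_corr_congr`). Graphs outside the boundary sector
have vanishing correlation functions, so the restriction to the boundary sector is immaterial.

*Classification.* Orbit counting for the relabellings of both kinds of vertices gives the mass formula
`∑ 1 / |Aut| = k!` (`sum_inv_autCard`). Therefore a list of graphs is a complete system of
representatives once its members are pairwise non-isomorphic and their masses add up to `k!`
(`sum_isoClass_eq_sum_list`). Non-isomorphism is detected by the numbers of closed paths of a few
shapes (`faceKey`).

*Edge removal.* Pulling back a function along a permutation of the momenta relabels the white vertices
of the graph it is paired with (`srcPair_permStar`). Hence each `Δ_{s,r} G_B ⋆ 𝕁(B ⊖ e_a^r)` can be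
rewritten with a standard graph instead of `B ⊖ e_a^r`, the required permutations being those of the
lists `removals0`, …, `removals3`. Recolouring reduces the properties of these lists to the case that
`a`, `b`, `c` are the colours `0`, `1`, `2`, a finite computation. The asserted identity is then one
between linear combinations of the same pairings.
-/

open TensorModel

noncomputable section

namespace TensorModel

variable {I : Fin 3 → Finset ℤ}

/-! ### Relabelling the vertices of a boundary graph -/

/-- The momentum of the black vertex `β` of `B`, if the white vertices carry the momenta `X`. -/
def blackMom {k : ℕ} (B : ColGraph k) (X : Fin k → Mom I) (β : Fin k) : Mom I :=
  fun c => X ((B c).symm β) c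

theorem blackMom_comp {k : ℕ} {B B' : ColGraph k} {π ρ : Equiv.Perm (Fin k)}
    (h : ∀ c μ, B' c (π μ) = ρ (B c μ)) (X : Fin k → Mom I) (β : Fin k) :
    blackMom B (X ∘ π) β = blackMom B' X (ρ β) := by
  funext c
  have : (B' c).symm (ρ β) = π ((B c).symm β) := by
    rw [Equiv.symm_apply_eq, h, Equiv.apply_symm_apply]
  simp [blackMom, this]

theorem cycle_comp {k : ℕ} {B B' : ColGraph k} {π ρ : Equiv.Perm (Fin k)}
    (h : ∀ c μ, B' c (π μ) = ρ (B c μ)) (X : Fin k → Mom I) :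
    cycle B (X ∘ π) = cycle B' X := by
  unfold cycle
  congr 1
  · exact Equiv.prod_comp π fun μ =>
      (MvPowerSeries.X (Sum.inl (X μ)) : SourceSeries I)
  · rw [← Equiv.prod_comp ρ fun β =>
      (MvPowerSeries.X (Sum.inr fun c => X ((B' c).symm β) c) : SourceSeries I)]
    exact Finset.prod_congr rfl fun β _ =>
      congrArg (fun x => (MvPowerSeries.X (Sum.inr x) : SourceSeries I)) (blackMom_comp h X β)

/-- Precomposition with a permutation, as a bijection of families of momenta. -/
def compEquiv {k : ℕ} (π : Equiv.Perm (Fin k)) : (Fin k → Mom I) ≃ (Fin k → Mom I) where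
  toFun X := X ∘ π
  invFun X := X ∘ π.symm
  left_inv X := by ext; simp
  right_inv X := by ext; simp

/-- Relabelling the white vertices of the source cycle amounts to pulling back the function that it
is paired with. -/
theorem srcPair_permStar {k : ℕ} {B T : ColGraph k} {σ ρ : Equiv.Perm (Fin k)}
    (h : ∀ c μ, B c (σ μ) = ρ (T c μ)) (f : MomFun I k) :
    srcPair (permStar σ f) T = srcPair f B := by
  unfold srcPair
  rw [← Equiv.sum_comp (compEquiv σ)]
  refine Finset.sum_congr rfl fun X _ => ?_
  change f ((X ∘ σ) ∘ σ.symm) • cycle T (X ∘ σ) = _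
  rw [cycle_comp h, Function.comp_assoc, Equiv.self_comp_symm, Function.comp_id]

/-! ### Relabelling the external legs of a Feynman graph -/

namespace FeynGraph

variable {n k : ℕ}

/-- Extension of a permutation of the external legs to all vertices. -/
def extPerm (n : ℕ) (π : Equiv.Perm (Fin k)) : Equiv.Perm (FVert n k) :=
  Equiv.sumCongr (Equiv.refl _) π

@[simp] theorem extPerm_inl (π : Equiv.Perm (Fin k)) (b : Fin n × Fin 2) :
    extPerm n π (Sum.inl b) = Sum.inl b := rfl

@[simp] theorem extPerm_inr (π : Equiv.Perm (Fin k)) (j : Fin k) :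
    extPerm n π (Sum.inr j) = Sum.inr (π j) := rfl

theorem extPerm_eq_inl {π : Equiv.Perm (Fin k)} {u : FVert n k} {b : Fin n × Fin 2} :
    extPerm n π u = Sum.inl b ↔ u = Sum.inl b := by
  cases u <;> simp

/-- The `J`-legs of the Feynman graph `G` are relabelled by `π`, its `J̄`-legs by `ρ`. -/
def relabel (π ρ : Equiv.Perm (Fin k)) (G : FeynGraph n k) : FeynGraph n k :=
  (G.1, (extPerm n π).symm.trans (G.2.trans (extPerm n ρ)))

theorem relabel_snd_apply (π ρ : Equiv.Perm (Fin k)) (G : FeynGraph n k) (u : FVert n k) :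
    (G.relabel π ρ).2 (extPerm n π u) = extPerm n ρ (G.2 u) := by
  simp [relabel]

/-- Relabelling the legs is a bijection of the set of labelled Feynman graphs. -/
def relabelEquiv (π ρ : Equiv.Perm (Fin k)) : FeynGraph n k ≃ FeynGraph n k where
  toFun := relabel π ρ
  invFun := relabel π.symm ρ.symm
  left_inv G := by
    refine Prod.ext rfl (Equiv.ext fun u => ?_)
    rcases u with b | j <;> simp [relabel, extPerm]
  right_inv G := by
    refine Prod.ext rfl (Equiv.ext fun u => ?_)
    rcases u with b | j <;> simp [relabel, extPerm]

theorem joined_relabel (π ρ : Equiv.Perm (Fin k)) (G : FeynGraph n k) (u v : FVert n k) :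
    (G.relabel π ρ).Joined (extPerm n π u) (extPerm n ρ v) ↔ G.Joined u v := by
  unfold Joined
  rw [relabel_snd_apply, (extPerm n ρ).injective.eq_iff]
  simp only [extPerm_eq_inl]
  rfl

theorem isConnected_relabel (π ρ : Equiv.Perm (Fin k)) (G : FeynGraph n k) :
    (G.relabel π ρ).IsConnected ↔ G.IsConnected := by
  refine (SimpleGraph.Iso.connected_iff
    ⟨Equiv.sumCongr (extPerm n π) (extPerm n ρ), ?_⟩).symm
  have key (G : FeynGraph n k) (x y : FVert n k ⊕ FVert n k) :
      (∃ u v, x = Sum.inl u ∧ y = Sum.inr v ∧ G.Joined u v) ↔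
        Sum.elim (fun u => Sum.elim (fun _ => False) (fun v => G.Joined u v) y)
          (fun _ => False) x := by
    rcases x with x | x <;> rcases y with y | y <;> simp
  intro x y
  simp only [SimpleGraph.fromRel_adj, key]
  rcases x with x | x <;> rcases y with y | y <;> simp [joined_relabel]

theorem path_relabel {π ρ : Equiv.Perm (Fin k)} {G : FeynGraph n k} {c : Fin 3}
    {u : FVert n k} {β : Fin k} (h : G.Path c u β) :
    (G.relabel π ρ).Path c (extPerm n π u) (ρ β) := by
  induction h with
  | last u β h => exact .last _ _ (by rw [relabel_snd_apply, h, extPerm_inr])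
  | step u b β h _ ih => exact .step _ b _ (by rw [relabel_snd_apply, h, extPerm_inl]) ih

theorem IsBoundary.relabel {B B' : ColGraph k} {π ρ : Equiv.Perm (Fin k)}
    (h : ∀ c μ, B' c (π μ) = ρ (B c μ)) {G : FeynGraph n k} (hG : G.IsBoundary B) :
    (G.relabel π ρ).IsBoundary B' := by
  intro c j
  have := path_relabel (π := π) (ρ := ρ) (hG c (π.symm j))
  rwa [← h, extPerm_inr, Equiv.apply_symm_apply] at this

theorem isBoundary_relabel_iff {B B' : ColGraph k} {π ρ : Equiv.Perm (Fin k)}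
    (h : ∀ c μ, B' c (π μ) = ρ (B c μ)) (G : FeynGraph n k) :
    (G.relabel π ρ).IsBoundary B' ↔ G.IsBoundary B := by
  refine ⟨fun hG => ?_, .relabel h⟩
  have h' : ∀ c μ, B c (π.symm μ) = ρ.symm (B' c μ) := fun c μ => by
    rw [Equiv.eq_symm_apply, ← h, Equiv.apply_symm_apply]
  have := IsBoundary.relabel h' hG
  rwa [show (G.relabel π ρ).relabel π.symm ρ.symm = G from
    (relabelEquiv π ρ).symm_apply_apply G] at this

theorem amplitude_relabel (E : Mom I → ℝ) (π ρ : Equiv.Perm (Fin k)) (G : FeynGraph n k)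
    (X : Fin k → Mom I) : (G.relabel π ρ).amplitude E X = G.amplitude E (X ∘ π) := by
  classical
  unfold amplitude
  refine Finset.sum_equiv ((extPerm n π).symm.arrowCongr (Equiv.refl (Mom I)))
    (fun p => ?_) fun p _ => ?_
  · simp only [Finset.mem_filter, Finset.mem_univ, true_and]
    refine and_congr ?_ ?_
    · rw [← π.forall_congr_right]
      rfl
    · rw [← (extPerm n π).forall_congr_right]
      simp only [relabel_snd_apply, extPerm_eq_inl]
      rfl
  · exact (Equiv.prod_comp (extPerm n π) fun u => ((E (p u) : ℂ))⁻¹).symm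

end FeynGraph

/-- The correlation function only depends on the isomorphism class of the boundary graph, up to the
labelling of the momenta. -/
theorem corr_comp (E : Mom I → ℝ) {k : ℕ} {B B' : ColGraph k} {π ρ : Equiv.Perm (Fin k)}
    (h : ∀ c μ, B' c (π μ) = ρ (B c μ)) (X : Fin k → Mom I) :
    corr E B (X ∘ π) = corr E B' X := by
  classical
  unfold corr
  congr 1
  funext n
  congr 1
  refine Finset.sum_equiv (FeynGraph.relabelEquiv π ρ) (fun G => ?_) fun G _ => ?_
  · simp only [Finset.mem_filter, Finset.mem_univ, true_and]
    exact (and_congr (FeynGraph.isConnected_relabel π ρ G)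
      (FeynGraph.isBoundary_relabel_iff h G)).symm
  · exact (FeynGraph.amplitude_relabel E π ρ G X).symm

theorem corr_eq_zero (E : Mom I → ℝ) {k : ℕ} {B : ColGraph k} (h : B ∉ boundarySector k) :
    corr E B = 0 := by
  classical
  funext X
  ext n
  simp only [corr, PowerSeries.coeff_mk, Pi.zero_apply, map_zero]
  rw [Finset.sum_eq_zero, mul_zero]
  intro G hG
  exact absurd ⟨n, G, (Finset.mem_filter.1 hG).2⟩ h

/-! ### Removal of an edge without reference to the order of the vertices -/

/-- The black vertex at which the edge of colour `c` of `B ⊖ e_a^r` starting at the white vertex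
`κ` ends, as a vertex of `B`. -/
def glue {k : ℕ} (B : ColGraph (k + 1)) (a : Fin 3) (r : Fin (k + 1)) (c : Fin 3) (κ : Fin k) :
    Fin (k + 1) :=
  if B c (r.succAbove κ) = B a r then B c r else B c (r.succAbove κ)

theorem succAbove_finSuccAboveEquiv_symm {k : ℕ} (p : Fin (k + 1)) (x : {x // x ≠ p}) :
    p.succAbove ((finSuccAboveEquiv p).symm x) = x :=
  congrArg Subtype.val ((finSuccAboveEquiv p).apply_symm_apply x)

theorem succAbove_remove {k : ℕ} (B : ColGraph (k + 1)) (a : Fin 3) (r : Fin (k + 1))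
    (c : Fin 3) (κ : Fin k) : (B a r).succAbove (remove B a r c κ) = glue B a r c κ := by
  have hne : B c (r.succAbove κ) ≠ B c r := (B c).injective.ne (Fin.succAbove_ne r κ)
  change (B a r).succAbove ((finSuccAboveEquiv (B a r)).symm ⟨_, _⟩) = _
  rw [succAbove_finSuccAboveEquiv_symm]
  change Equiv.swap (B a r) (B c r) (B c (r.succAbove κ)) = _
  unfold glue
  split_ifs with h
  · rw [h, Equiv.swap_apply_left]
  · exact Equiv.swap_apply_of_ne_of_ne h hne

open Classical in
/-- The contribution of the edge `e_a^r` to the pairing of `F` with `B`, as a sum over the momenta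
of all the white vertices of `B`: those at both ends of the removed edge have to agree, and the
sources at these two vertices are absent. -/
def removalSum {k : ℕ} (B : ColGraph k) (a : Fin 3) (s : I a) (r : Fin k) (F : MomFun I k) :
    SourceSeries I :=
  ∑ X : Fin k → Mom I with X r a = s ∧ blackMom B X (B a r) = X r,
    F X • ((∏ μ ∈ Finset.univ.erase r, MvPowerSeries.X (Sum.inl (X μ))) *
      ∏ β ∈ Finset.univ.erase (B a r), MvPowerSeries.X (Sum.inr (blackMom B X β)))

theorem prod_succAbove_eq_prod_erase {M : Type*} [CommMonoid M] {k : ℕ} (r : Fin (k + 1))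
    (f : Fin (k + 1) → M) : ∏ κ, f (r.succAbove κ) = ∏ μ ∈ Finset.univ.erase r, f μ := by
  have : Finset.univ.erase r = Finset.univ.map r.succAboveEmb := by
    rw [Fin.univ_succAbove k r, Finset.erase_cons]
  rw [this, Finset.prod_map]
  rfl

theorem srcPair_Delta {k : ℕ} (B : ColGraph (k + 1)) (a : Fin 3) (s : I a) (r : Fin (k + 1))
    (F : MomFun I (k + 1)) :
    srcPair (Delta B a s r F) (remove B a r) = removalSum B a s r F := by
  classical
  unfold srcPair Delta removalSum
  simp only [Finset.sum_smul, Finset.sum_filter]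
  rw [Finset.sum_comm, ← Finset.sum_product', Finset.univ_product_univ]
  -- The inserted momentum and those of the other white vertices form a family on all of `B`.
  refine Fintype.sum_equiv (Fin.insertNthEquiv (fun _ => Mom I) r) _ _ ?_
  rintro ⟨z, Y⟩
  have hX (μ) : Fin.insertNthEquiv (fun _ => Mom I) r (z, Y) μ =
    r.insertNth (α := fun _ => Mom I) z Y μ := rfl
  generalize hXdef : Fin.insertNthEquiv (fun _ => Mom I) r (z, Y) = X at *
  have hXr : X r = z := by rw [hX, Fin.insertNth_apply_same]
  have hXs (κ) : X (r.succAbove κ) = Y κ := by rw [hX, Fin.insertNth_apply_succAbove]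
  have hF : r.insertNth (α := fun _ => Mom I) z Y = X := hXdef
  have hcond : (z a = s ∧ ∀ i κ, B i (r.succAbove κ) = B a r → z i = Y κ i) ↔
      (X r a = s ∧ blackMom B X (B a r) = X r) := by
    rw [hXr]
    refine and_congr_right fun _ => ⟨fun h => ?_, fun h i κ hκ => ?_⟩
    · funext i
      rcases Fin.eq_self_or_eq_succAbove r ((B i).symm (B a r)) with hr | ⟨κ, hκ⟩
      · rw [blackMom, hr, hXr]
      · rw [blackMom, hκ, hXs, h i κ]
        rw [← hκ, Equiv.apply_symm_apply]
    · rw [← h, blackMom, ← hκ, Equiv.symm_apply_apply, hXs]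
  by_cases hz : X r a = s ∧ blackMom B X (B a r) = X r
  · rw [if_pos hz]
    dsimp only
    rw [if_pos (hcond.2 hz), hF, ← prod_succAbove_eq_prod_erase r,
      ← prod_succAbove_eq_prod_erase (B a r)]
    unfold cycle
    simp only [hXs]
    congr 2
    refine Finset.prod_congr rfl fun β _ => ?_
    congr 2
    funext c
    obtain ⟨κ, rfl⟩ := (remove B a r c).surjective β
    rw [succAbove_remove, Equiv.symm_apply_apply, blackMom, glue]
    -- If the edge of colour `c` has been glued, the constraint makes the momenta of its parts agree.
    split_ifs with h
    · rw [Equiv.symm_apply_apply, hXr]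
      exact ((hcond.2 hz).2 c κ h).symm
    · rw [Equiv.symm_apply_apply, hXs]
  · rw [if_neg hz]
    dsimp only
    rw [if_neg (hcond.not.2 hz), zero_smul]

theorem removalSum_comp {k : ℕ} {B B' : ColGraph k} {π ρ : Equiv.Perm (Fin k)}
    (h : ∀ c μ, B' c (π μ) = ρ (B c μ)) (a : Fin 3) (s : I a) (r : Fin k) {F F' : MomFun I k}
    (hF : ∀ X, F (X ∘ π) = F' X) :
    removalSum B a s r F = removalSum B' a s (π r) F' := by
  classical
  unfold removalSum
  symm
  refine Finset.sum_equiv (compEquiv π) (fun X => ?_) fun X _ => ?_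
  · simp only [Finset.mem_filter, Finset.mem_univ, true_and]
    change _ ↔ (X ∘ π) r a = s ∧ blackMom B (X ∘ π) (B a r) = (X ∘ π) r
    rw [blackMom_comp h, h]
    rfl
  · change _ = F (X ∘ π) • (_ * ∏ β ∈ _, MvPowerSeries.X (Sum.inr (blackMom B (X ∘ π) β)))
    rw [hF]
    congr 2
    · symm
      refine Finset.prod_equiv π (fun μ => by simp) fun μ _ => rfl
    · symm
      refine Finset.prod_equiv ρ (fun β => ?_) fun β _ => by rw [blackMom_comp h]
      simp [h]

theorem pairing_eq_sum_removalSum {k : ℕ} (a : Fin 3) (s : I a) (F : MomFun I (k + 1))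
    (B : ColGraph (k + 1)) : pairing a s F B = ∑ r, removalSum B a s r F :=
  Finset.sum_congr rfl fun r _ => srcPair_Delta B a s r F

/-- The contribution of a boundary graph to `Y^{(a)}` only depends on its isomorphism class. -/
theorem pairing_corr_congr (E : Mom I → ℝ) (a : Fin 3) (s : I a) {k : ℕ}
    {B B' : ColGraph (k + 1)} (h : (isoSetoid (k + 1)).r B B') :
    pairing a s (corr E B) B = pairing a s (corr E B') B' := by
  obtain ⟨π, ρ, h⟩ := h
  rw [pairing_eq_sum_removalSum, pairing_eq_sum_removalSum,
    ← Equiv.sum_comp π fun r => removalSum B' a s r (corr E B')]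
  exact Finset.sum_congr rfl fun r _ =>
    removalSum_comp h a s r (F := corr E B) (F' := corr E B') (corr_comp E h)

/-! ### The mass formula for coloured graphs -/

/-- Pairs of permutations act on the coloured graphs by relabelling the white and the black
vertices. -/
abbrev relabelAction (k : ℕ) :
    MulAction (Equiv.Perm (Fin k) × Equiv.Perm (Fin k)) (ColGraph k) where
  smul p B := fun c => p.2 * B c * p.1⁻¹
  one_smul B := by
    funext c
    change (1 : Equiv.Perm (Fin k)) * B c * 1⁻¹ = B c
    simp
  mul_smul p q B := by
    funext c
    change (p.2 * q.2) * B c * (p.1 * q.1)⁻¹ = p.2 * (q.2 * B c * q.1⁻¹) * p.1⁻¹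
    group

theorem relabelAction_smul_eq_iff {k : ℕ} (p : Equiv.Perm (Fin k) × Equiv.Perm (Fin k))
    (B B' : ColGraph k) :
    letI := relabelAction k
    p • B = B' ↔ ∀ c μ, B' c (p.1 μ) = p.2 (B c μ) := by
  change (fun c => p.2 * B c * p.1⁻¹) = B' ↔ _
  rw [funext_iff]
  refine forall_congr' fun c => ?_
  rw [mul_inv_eq_iff_eq_mul, Equiv.ext_iff]
  exact forall_congr' fun μ => eq_comm

theorem card_isoClass_mul_autCard {k : ℕ} (B : ColGraph k) :
    Nat.card {B' // (isoSetoid k).r B B'} * autCard B = k.factorial ^ 2 := by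
  classical
  let _ := relabelAction k
  have h := MulAction.card_orbit_mul_card_stabilizer_eq_card_group
    (Equiv.Perm (Fin k) × Equiv.Perm (Fin k)) B
  rw [Fintype.card_prod, Fintype.card_perm, Fintype.card_fin, ← sq, ← Nat.card_eq_fintype_card,
    ← Nat.card_eq_fintype_card] at h
  rw [← h]
  congr 1
  · refine Nat.card_congr (Equiv.subtypeEquivRight fun B' => ?_)
    constructor
    · rintro ⟨π, ρ, h⟩
      exact ⟨(π, ρ), (relabelAction_smul_eq_iff (π, ρ) B B').2 h⟩
    · rintro ⟨p, h⟩
      exact ⟨p.1, p.2, (relabelAction_smul_eq_iff p B B').1 h⟩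
  · exact Nat.card_congr (Equiv.subtypeEquivRight fun p =>
      (relabelAction_smul_eq_iff p B B).symm)

theorem autCard_congr {k : ℕ} {B B' : ColGraph k} (h : (isoSetoid k).r B B') :
    autCard B = autCard B' := by
  have hc : Nat.card {C // (isoSetoid k).r B C} = Nat.card {C // (isoSetoid k).r B' C} :=
    Nat.card_congr (Equiv.subtypeEquivRight fun C =>
      ⟨(isoSetoid k).iseqv.trans ((isoSetoid k).iseqv.symm h), (isoSetoid k).iseqv.trans h⟩)
  have h1 := card_isoClass_mul_autCard B
  have h2 := card_isoClass_mul_autCard B'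
  have hpos : 0 < k.factorial ^ 2 := by positivity
  rw [hc, ← h2] at h1
  exact Nat.eq_of_mul_eq_mul_left (Nat.pos_of_mul_pos_right (h2 ▸ hpos)) h1

theorem autCard_pos {k : ℕ} (B : ColGraph k) : 0 < autCard B :=
  Nat.pos_of_mul_pos_left (card_isoClass_mul_autCard B ▸ (by positivity : 0 < k.factorial ^ 2))

open Classical in
/-- The mass formula: the sum of `1 / |Aut|` over the isomorphism classes of graphs with `k` white
vertices is `(k!)³ / (k!)²`. -/
theorem sum_inv_autCard (k : ℕ) :
    ∑ q : Quotient (isoSetoid k), ((autCard q.out : ℚ))⁻¹ = k.factorial := by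
  classical
  have hcard : ∑ q : Quotient (isoSetoid k), Nat.card {B // (isoSetoid k).r q.out B} =
      k.factorial ^ 3 := by
    have h : Fintype.card (ColGraph k) = k.factorial ^ 3 := by
      simp [ColGraph, Fintype.card_perm]
    rw [← h, ← Fintype.card_congr (Equiv.sigmaFiberEquiv (Quotient.mk (isoSetoid k))),
      Fintype.card_sigma]
    refine Finset.sum_congr rfl fun q _ => ?_
    rw [← Nat.card_eq_fintype_card]
    refine Nat.card_congr (Equiv.subtypeEquivRight fun B => ?_)
    rw [← Quotient.out_eq q, Quotient.eq, Quotient.out_eq]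
    exact ⟨(isoSetoid k).iseqv.symm, (isoSetoid k).iseqv.symm⟩
  have hk : (k.factorial : ℚ) ≠ 0 := by positivity
  have hq (q : Quotient (isoSetoid k)) : ((autCard q.out : ℚ))⁻¹ =
      Nat.card {B // (isoSetoid k).r q.out B} / (k.factorial : ℚ) ^ 2 := by
    have h0 : (autCard q.out : ℚ) ≠ 0 := by exact_mod_cast (autCard_pos q.out).ne'
    have := card_isoClass_mul_autCard q.out
    field_simp
    rw [mul_comm]
    exact_mod_cast this.symm
  rw [Finset.sum_congr rfl fun q _ => hq q, ← Finset.sum_div, ← Nat.cast_sum, hcard]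
  push_cast
  field_simp

theorem nodup_map_mk {k : ℕ} {L : List (ColGraph k)}
    (hL : L.Pairwise fun B B' => ¬ (isoSetoid k).r B B') :
    (L.map (Quotient.mk (isoSetoid k))).Nodup := by
  rw [List.Nodup, List.pairwise_map]
  exact hL.imp fun h h' => h (Quotient.exact h')

open Classical in
theorem sum_toFinset_map_mk {k : ℕ} {M : Type*} [AddCommMonoid M] {L : List (ColGraph k)}
    (hL : L.Pairwise fun B B' => ¬ (isoSetoid k).r B B') (f : ColGraph k → M)
    (hf : ∀ B B', (isoSetoid k).r B B' → f B = f B') :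
    ∑ q ∈ (L.map (Quotient.mk (isoSetoid k))).toFinset, f q.out = (L.map f).sum := by
  rw [List.sum_toFinset _ (nodup_map_mk hL), List.map_map]
  refine congrArg List.sum (List.map_congr_left fun B _ => ?_)
  exact hf _ _ (Quotient.mk_out (s := isoSetoid k) B)

open Classical in
/-- Pairwise non-isomorphic graphs represent all the isomorphism classes as soon as their masses
add up to the total mass. -/
theorem sum_isoClass_eq_sum_list {k : ℕ} {M : Type*} [AddCommMonoid M] (L : List (ColGraph k))
    (hL : L.Pairwise fun B B' => ¬ (isoSetoid k).r B B')
    (hmass : (L.map fun B => ((autCard B : ℚ))⁻¹).sum = k.factorial) (f : ColGraph k → M)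
    (hf : ∀ B B', (isoSetoid k).r B B' → f B = f B') :
    ∑ q : Quotient (isoSetoid k), f q.out = (L.map f).sum := by
  have huniv : (L.map (Quotient.mk (isoSetoid k))).toFinset = Finset.univ := by
    -- All masses are positive, so a missing class would make the sum over the list too small.
    by_contra hne
    obtain ⟨q, -, hq⟩ := Finset.exists_of_ssubset (Finset.ssubset_univ_iff.2 hne)
    have hlt := Finset.sum_lt_sum_of_subset (Finset.subset_univ _) (Finset.mem_univ q) hq
      (f := fun q : Quotient (isoSetoid k) => ((autCard q.out : ℚ))⁻¹)
      (inv_pos.2 (by exact_mod_cast autCard_pos _)) fun _ _ _ => by positivity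
    rw [sum_toFinset_map_mk hL (fun B => ((autCard B : ℚ))⁻¹) fun B B' h => by rw [autCard_congr h], hmass,
      sum_inv_autCard] at hlt
    exact lt_irrefl _ hlt
  rw [← huniv, sum_toFinset_map_mk hL f hf]

/-! ### Invariants of coloured graphs -/

/-- The permutation of the white vertices that follows the edge of colour `c` and returns along
that of colour `0`. -/
def faceStep {k : ℕ} (B : ColGraph k) (c : Fin 3) : Equiv.Perm (Fin k) := (B c).trans (B 0).symm

theorem faceStep_comp {k : ℕ} {B B' : ColGraph k} {π ρ : Equiv.Perm (Fin k)}
    (h : ∀ c μ, B' c (π μ) = ρ (B c μ)) (c : Fin 3) :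
    faceStep B' c = π.symm.trans ((faceStep B c).trans π) := by
  ext μ
  obtain ⟨μ, rfl⟩ := π.surjective μ
  have h0 (x) : (B' 0).symm (ρ x) = π ((B 0).symm x) := by
    rw [Equiv.symm_apply_eq, h, Equiv.apply_symm_apply]
  simp [faceStep, h, h0]

/-- The number of fixed points of a permutation. -/
def fixCount {k : ℕ} (σ : Equiv.Perm (Fin k)) : ℕ := Fintype.card {μ // σ μ = μ}

theorem fixCount_conj {k : ℕ} (σ π : Equiv.Perm (Fin k)) :
    fixCount (π.symm.trans (σ.trans π)) = fixCount σ := by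
  refine Fintype.card_congr (π.symm.subtypeEquiv fun μ => ?_)
  simp [Equiv.eq_symm_apply]

/-- The numbers of closed paths of the shapes `β`, `γ`, `βγ`, `β²` and `β²γ⁻²`, where `β` and `γ`
follow the edges of colours `1` and `2` and return along those of colour `0`. They distinguish all
the graphs with at most 4 white vertices. -/
def faceKey {k : ℕ} (B : ColGraph k) : List ℕ :=
  let β := faceStep B 1
  let γ := faceStep B 2
  [fixCount β, fixCount γ, fixCount (β.trans γ), fixCount (β.trans β),
    fixCount ((β.trans β).trans (γ.trans γ).symm)]

theorem faceKey_congr {k : ℕ} {B B' : ColGraph k} (h : (isoSetoid k).r B B') :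
    faceKey B = faceKey B' := by
  obtain ⟨π, ρ, h⟩ := h
  have hconj (σ τ : Equiv.Perm (Fin k)) :
      (π.symm.trans (σ.trans π)).trans (π.symm.trans (τ.trans π)) =
        π.symm.trans ((σ.trans τ).trans π) := by
    ext μ
    simp
  have hsymm (σ : Equiv.Perm (Fin k)) :
      (π.symm.trans (σ.trans π)).symm = π.symm.trans (σ.symm.trans π) := rfl
  simp only [faceKey, faceStep_comp h, hconj, hsymm, fixCount_conj]

/-- The number of coloured automorphisms, counted by their action on the white vertices. -/
def autCount {k : ℕ} (B : ColGraph k) : ℕ :=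
  Fintype.card {π : Equiv.Perm (Fin k) // ∀ μ, faceStep B 1 (π μ) = π (faceStep B 1 μ) ∧
    faceStep B 2 (π μ) = π (faceStep B 2 μ)}

theorem autCard_eq_autCount {k : ℕ} (B : ColGraph k) : autCard B = autCount B := by
  rw [autCard, autCount, ← Nat.card_eq_fintype_card]
  refine Nat.card_congr
    { toFun := fun p => ⟨p.1.1, ?_⟩
      invFun := fun π => ⟨(π.1, (B 0).symm.trans (π.1.trans (B 0))), ?_⟩
      left_inv := ?_
      right_inv := fun π => rfl }
  · have h := faceStep_comp p.2
    have h' (c μ) : faceStep B c (p.1.1 μ) = p.1.1 (faceStep B c μ) := by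
      conv_lhs => rw [h c]
      simp
    exact fun μ => ⟨h' 1 μ, h' 2 μ⟩
  · intro c μ
    have h : faceStep B c (π.1 μ) = π.1 (faceStep B c μ) := by
      fin_cases c
      · simp [faceStep]
      · exact (π.2 μ).1
      · exact (π.2 μ).2
    simpa [faceStep, Equiv.symm_apply_eq] using h
  · rintro ⟨⟨π, ρ⟩, h⟩
    refine Subtype.ext (Prod.ext rfl (Equiv.ext fun x => ?_))
    obtain ⟨μ, rfl⟩ := (B 0).surjective x
    simpa using h 0 μ

/-! ### Recolouring -/

/-- The graph whose edges of colour `c` are those of colour `e c` in `B`. -/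
def recolour {k : ℕ} (e : Equiv.Perm (Fin 3)) (B : ColGraph k) : ColGraph k := fun c => B (e c)

theorem isoSetoid_recolour {k : ℕ} (e : Equiv.Perm (Fin 3)) {B B' : ColGraph k}
    (h : (isoSetoid k).r B B') : (isoSetoid k).r (recolour e B) (recolour e B') := by
  obtain ⟨π, ρ, h⟩ := h
  exact ⟨π, ρ, fun c => h (e c)⟩

theorem autCard_recolour {k : ℕ} (e : Equiv.Perm (Fin 3)) (B : ColGraph k) :
    autCard (recolour e B) = autCard B :=
  Nat.card_congr (Equiv.subtypeEquivRight fun p =>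
    e.forall_congr_right (q := fun c => ∀ μ, B c (p.1 μ) = p.2 (B c μ)))

/-! ### Edge removals -/

/-- A graph with the number of its automorphisms and, for each white vertex `r`, a graph isomorphic
to the one obtained by removing the edge of a fixed colour at `r`, with the part of an isomorphism
that concerns the white vertices. -/
structure Removal (k : ℕ) where
  /-- The graph whose edges are removed. -/
  graph : ColGraph (k + 1)
  /-- The number of automorphisms of `graph`. -/
  aut : ℕ
  /-- The white vertices of `target r`, as vertices of the graph without the edge at `r`. -/
  perm : Fin (k + 1) → Equiv.Perm (Fin k)
  /-- The isomorphism type of the graph without the edge at `r`. -/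
  target : Fin (k + 1) → ColGraph k

/-- Recolouring of all the graphs involved. -/
def Removal.recolour {k : ℕ} (e : Equiv.Perm (Fin 3)) (R : Removal k) : Removal k where
  graph := TensorModel.recolour e R.graph
  aut := R.aut
  perm := R.perm
  target := TensorModel.recolour e ∘ R.target

/-- The given data are correct for the removal of the edges of colour `0`: the number of automorphisms
is as stated, and the map `R.perm r` of the white vertices induces the same map of the black vertices
along the edges of each colour, so that it extends to an isomorphism. -/
def Removal.Valid {k : ℕ} (R : Removal k) : Prop :=
  autCount R.graph = R.aut ∧ ∀ r c κ, glue R.graph 0 r c (R.perm r κ) =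
    glue R.graph 0 r 0 (R.perm r ((R.target r 0).symm (R.target r c κ)))

instance {k : ℕ} (R : Removal k) : Decidable R.Valid := by
  unfold Removal.Valid
  infer_instance

theorem Removal.srcPair_Delta_eq {k : ℕ} {e : Equiv.Perm (Fin 3)} {R : Removal k}
    (h : (R.recolour e).Valid) (s : I (e 0)) (r : Fin (k + 1)) (F : MomFun I (k + 1)) :
    srcPair (Delta R.graph (e 0) s r F) (remove R.graph (e 0) r) =
      srcPair (permStar (R.perm r) (Delta R.graph (e 0) s r F)) (R.target r) := by
  refine (srcPair_permStar (ρ := (R.target r (e 0)).symm.trans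
    ((R.perm r).trans (remove R.graph (e 0) r (e 0)))) (fun c κ => ?_) _).symm
  -- Black vertices of the graph without the edge are compared as vertices of `R.graph`.
  obtain ⟨c, rfl⟩ := e.surjective c
  apply Fin.succAbove_right_injective (p := R.graph (e 0) r)
  rw [succAbove_remove]
  simp only [Equiv.trans_apply]
  rw [succAbove_remove]
  exact h.2 r c κ

/-- Pairwise non-isomorphic graphs of the right total mass yield the whole part of `Y^{(a)}` that
is homogeneous of degree `2 k`. -/
theorem Yterm_eq_sum_removals (E : Mom I → ℝ) (e : Equiv.Perm (Fin 3)) (s : I (e 0)) {k : ℕ}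
    (L L₀ : List (Removal k)) (hL : L.map (Removal.recolour e) = L₀)
    (hvalid : ∀ R ∈ L₀, R.Valid) (hkey : (L₀.map fun R => faceKey R.graph).Nodup)
    (hmass : (L₀.map fun R => ((R.aut : ℚ))⁻¹).sum = (k + 1).factorial) :
    Yterm E (e 0) s k = (L.map fun R => ((R.aut : ℂ)⁻¹) •
      ∑ r, srcPair (permStar (R.perm r) (D E s r R.graph)) (R.target r)).sum := by
  classical
  subst hL
  have hvalid' : ∀ R ∈ L, (R.recolour e).Valid := fun R hR =>
    hvalid _ (List.mem_map_of_mem hR)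
  have haut : ∀ R ∈ L, autCard R.graph = R.aut := fun R hR => by
    rw [← autCard_recolour e, autCard_eq_autCount]
    exact (hvalid' R hR).1
  have hout (q : Quotient (isoSetoid (k + 1))) :
      (if q.out ∈ boundarySector (k + 1) then
        ((autCard q.out : ℂ)⁻¹) • pairing (e 0) s (corr E q.out) q.out else 0) =
      ((autCard q.out : ℂ)⁻¹) • pairing (e 0) s (corr E q.out) q.out := by
    split_ifs with hq
    · rfl
    · have h0 : pairing (e 0) s (0 : MomFun I (k + 1)) q.out = 0 := by
        rw [pairing_eq_sum_removalSum]
        simp [removalSum]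
      rw [corr_eq_zero E hq, h0, smul_zero]
  have hpair : (L.map Removal.graph).Pairwise fun B B' => ¬ (isoSetoid (k + 1)).r B B' := by
    rw [List.map_map, List.Nodup, List.pairwise_map] at hkey
    rw [List.pairwise_map]
    exact hkey.imp fun h h' => h (faceKey_congr (isoSetoid_recolour e h'))
  have hmass' : ((L.map Removal.graph).map fun B => ((autCard B : ℚ))⁻¹).sum =
      (k + 1).factorial := by
    rw [← hmass, List.map_map, List.map_map]
    refine congrArg List.sum (List.map_congr_left fun R hR => ?_)
    simp [haut R hR, Removal.recolour]
  have hsum := sum_isoClass_eq_sum_list (L.map Removal.graph) hpair hmass'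
    (fun B => ((autCard B : ℂ)⁻¹) • pairing (e 0) s (corr E B) B)
    fun B B' h => by rw [autCard_congr h, pairing_corr_congr E (e 0) s h]
  refine (Finset.sum_congr rfl fun q _ => hout q).trans (hsum.trans ?_)
  rw [List.map_map]
  refine congrArg List.sum (List.map_congr_left fun R hR => ?_)
  simp only [Function.comp_apply, haut R hR]
  refine congrArg _ ?_
  exact Finset.sum_congr rfl fun r _ => Removal.srcPair_Delta_eq (hvalid' R hR) s r _

/-! ### The degree in the sources -/

theorem prod_X_eq_monomial {σ ι R : Type*} [CommSemiring R] (t : Finset ι) (f : ι → σ) :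
    (∏ i ∈ t, MvPowerSeries.X (f i) : MvPowerSeries σ R) =
      MvPowerSeries.monomial (∑ i ∈ t, Finsupp.single (f i) 1) 1 := by
  classical
  induction t using Finset.induction_on with
  | empty => rfl
  | insert i t hi ih =>
    rw [Finset.prod_insert hi, Finset.sum_insert hi, ih, MvPowerSeries.X_def,
      MvPowerSeries.monomial_mul_monomial, one_mul]

theorem coeff_cycle_of_degree_ne {k : ℕ} (B : ColGraph k) (X : Fin k → Mom I)
    (m : (Mom I ⊕ Mom I) →₀ ℕ) (hm : m.degree ≠ 2 * k) :
    MvPowerSeries.coeff m (cycle B X) = 0 := by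
  classical
  rw [cycle, prod_X_eq_monomial, prod_X_eq_monomial, MvPowerSeries.monomial_mul_monomial,
    MvPowerSeries.coeff_monomial, if_neg]
  rintro rfl
  refine hm ?_
  simp [map_sum, two_mul]

theorem coeff_srcPair_of_degree_ne {k : ℕ} (f : MomFun I k) (B : ColGraph k)
    (m : (Mom I ⊕ Mom I) →₀ ℕ) (hm : m.degree ≠ 2 * k) :
    MvPowerSeries.coeff m (srcPair f B) = 0 := by
  rw [srcPair, map_sum]
  refine Finset.sum_eq_zero fun X _ => ?_
  rw [map_smul, coeff_cycle_of_degree_ne B X m hm, smul_zero]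

theorem coeff_Yterm_of_degree_ne (E : Mom I → ℝ) (a : Fin 3) (s : I a) (l : ℕ)
    (m : (Mom I ⊕ Mom I) →₀ ℕ) (hm : m.degree ≠ 2 * l) :
    MvPowerSeries.coeff m (Yterm E a s l) = 0 := by
  rw [Yterm, map_sum]
  refine Finset.sum_eq_zero fun q _ => ?_
  split_ifs
  · change (_ : ℂ) • MvPowerSeries.coeff m (pairing a s (corr E q.out) q.out) = 0
    rw [pairing, map_sum, Finset.sum_eq_zero fun r _ => coeff_srcPair_of_degree_ne _ _ m hm,
      smul_zero]
  · exact map_zero _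

theorem coeff_Y_of_degree_lt (E : Mom I → ℝ) (a : Fin 3) (s : I a) (N : ℕ)
    (m : (Mom I ⊕ Mom I) →₀ ℕ) (hm : m.degree < 2 * N) :
    MvPowerSeries.coeff m (Y E a s) =
      MvPowerSeries.coeff m (∑ l ∈ Finset.range N, Yterm E a s l) := by
  change ∑ l ∈ Finset.range (m.degree + 1), MvPowerSeries.coeff m (Yterm E a s l) = _
  rw [map_sum]
  have h (n : ℕ) (hn : m.degree < 2 * n) :
      ∑ l ∈ Finset.range n, MvPowerSeries.coeff m (Yterm E a s l) =
        ∑ l ∈ Finset.range n with m.degree = 2 * l, MvPowerSeries.coeff m (Yterm E a s l) := by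
    rw [Finset.sum_filter]
    refine Finset.sum_congr rfl fun l _ => ?_
    split_ifs with hl
    · rfl
    · exact coeff_Yterm_of_degree_ne E a s l m hl
  rw [h _ (by omega), h N hm]
  refine Finset.sum_congr ?_ fun _ _ => rfl
  ext l
  simp only [Finset.mem_filter, Finset.mem_range]
  omega

/-! ### Linearity of the pairing with a source cycle -/

@[simp] theorem permStar_one {k : ℕ} (f : MomFun I k) : permStar 1 f = f := rfl

theorem permStar_add {k : ℕ} (σ : Equiv.Perm (Fin k)) (f g : MomFun I k) :
    permStar σ (f + g) = permStar σ f + permStar σ g := rfl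

theorem srcPair_add {k : ℕ} (f g : MomFun I k) (B : ColGraph k) :
    srcPair (f + g) B = srcPair f B + srcPair g B := by
  simp [srcPair, add_smul, Finset.sum_add_distrib]

theorem srcPair_smul {k : ℕ} (z : ℂ) (f : MomFun I k) (B : ColGraph k) :
    srcPair (z • f) B = z • srcPair f B := by
  simp [srcPair, Finset.smul_sum]

/-! ### The graphs with at most 8 vertices and their edge removals -/

/-- The removal of the edges of colour `a` from the graph with 2 vertices. -/
def removals0 : List (Removal 0) :=
  [⟨gm, 1, ![1], ![gEmpty]⟩]

/-- The removal of the edges of colour `a` from the graphs with 4 vertices, one for each isomorphism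
class, if `a`, `b`, `c` are the three colours. -/
def removals1 (a b c : Fin 3) : List (Removal 1) :=
  [⟨gmm, 2, ![1, 1], ![gm, gm]⟩,
    ⟨gV a, 2, ![1, 1], ![gm, gm]⟩,
    ⟨gV b, 2, ![1, 1], ![gm, gm]⟩,
    ⟨gV c, 2, ![1, 1], ![gm, gm]⟩]

/-- The removal of the edges of colour `a` from the graphs with 6 vertices, one for each isomorphism
class, if `a`, `b`, `c` are the three colours. -/
def removals2 (a b c : Fin 3) : List (Removal 2) :=
  [⟨gmmm, 6, ![1, 1, 1], ![gmm, gmm, gmm]⟩,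
    ⟨gmV a, 2, ![1, 1, 1], ![gV a, gmm, gmm]⟩,
    ⟨gmV b, 2, ![1, 1, 1], ![gV b, gmm, gmm]⟩,
    ⟨gmV c, 2, ![1, 1, 1], ![gV c, gmm, gmm]⟩,
    ⟨gQ a, 3, ![1, 1, 1], ![gV a, gV a, gV a]⟩,
    ⟨gQ b, 3, ![1, 1, 1], ![gV b, gV b, gV b]⟩,
    ⟨gQ c, 3, ![1, 1, 1], ![gV c, gV c, gV c]⟩,
    ⟨gE a b, 1, ![1, 1, 1], ![gV c, gmm, gV b]⟩,
    ⟨gE b a, 1, ![1, 1, 1], ![gV c, gV c, gV a]⟩,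
    ⟨gE c a, 1, ![1, 1, 1], ![gV b, gV b, gV a]⟩,
    ⟨gK a b, 3, ![1, 1, 1], ![gV a, gV a, gV a]⟩]

/-- The removal of the edges of colour `a` from the graphs with 8 vertices, one for each isomorphism
class, if `a`, `b`, `c` are the three colours. -/
def removals3 (a b c : Fin 3) : List (Removal 3) :=
  [⟨gmmmm, 24, ![1, 1, 1, 1], ![gmmm, gmmm, gmmm, gmmm]⟩,
    ⟨gmmV a, 4, ![1, 1, 1, 1], ![gmV a, gmV a, gmmm, gmmm]⟩,
    ⟨gmmV b, 4, ![1, 1, 1, 1], ![gmV b, gmV b, gmmm, gmmm]⟩,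
    ⟨gmmV c, 4, ![1, 1, 1, 1], ![gmV c, gmV c, gmmm, gmmm]⟩,
    ⟨gVV a a, 8, ![1, 1, p132, p132], ![gmV a, gmV a, gmV a, gmV a]⟩,
    ⟨gVV b a, 4, ![1, 1, p132, p132], ![gmV a, gmV a, gmV b, gmV b]⟩,
    ⟨gVV b b, 8, ![1, 1, p132, p132], ![gmV b, gmV b, gmV b, gmV b]⟩,
    ⟨gVV b c, 4, ![1, 1, p132, p132], ![gmV c, gmV c, gmV b, gmV b]⟩,
    ⟨gVV c a, 4, ![1, 1, p132, p132], ![gmV a, gmV a, gmV c, gmV c]⟩,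
    ⟨gVV c c, 8, ![1, 1, p132, p132], ![gmV c, gmV c, gmV c, gmV c]⟩,
    ⟨gmQ a, 3, ![1, 1, 1, 1], ![gQ a, gmV a, gmV a, gmV a]⟩,
    ⟨gmQ b, 3, ![1, 1, 1, 1], ![gQ b, gmV b, gmV b, gmV b]⟩,
    ⟨gmQ c, 3, ![1, 1, 1, 1], ![gQ c, gmV c, gmV c, gmV c]⟩,
    ⟨gmE a b, 1, ![1, 1, 1, 1], ![gE a b, gmV c, gmmm, gmV b]⟩,
    ⟨gmE b a, 1, ![1, 1, 1, 1], ![gE b a, gmV c, gmV c, gmV a]⟩,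
    ⟨gmE c a, 1, ![1, 1, 1, 1], ![gE c a, gmV b, gmV b, gmV a]⟩,
    ⟨gmK a b, 3, ![1, 1, 1, 1], ![gK a b, gmV a, gmV a, gmV a]⟩,
    ⟨gA a, 4, ![1, 1, 1, 1], ![gQ a, gQ a, gQ a, gQ a]⟩,
    ⟨gA b, 4, ![1, 1, 1, 1], ![gQ b, gQ b, gQ b, gQ b]⟩,
    ⟨gA c, 4, ![1, 1, 1, 1], ![gQ c, gQ c, gQ c, gQ c]⟩,
    ⟨gW a b, 1, ![1, 1, 1, p13], ![gE b a, gE a b, gE a b, gE c a]⟩,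
    ⟨gW b c, 1, ![p13, 1, p13, p13], ![gE c a, gmV a, gE a b, gE a b]⟩,
    ⟨gW c a, 1, ![p13, p13, p132, 1], ![gE a b, gE a b, gmV a, gE b a]⟩,
    ⟨gR a b, 2, ![1, 1, p132, p13], ![gE a b, gmV c, gmV c, gE a b]⟩,
    ⟨gR a c, 2, ![p13, 1, p132, 1], ![gE a b, gmV b, gmV b, gE a b]⟩,
    ⟨gR b a, 2, ![1, 1, p13, p13], ![gE b a, gQ c, gQ c, gE b a]⟩,
    ⟨gR b c, 2, ![p13, p13, 1, 1], ![gE b a, gE b a, gE b a, gE b a]⟩,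
    ⟨gR c a, 2, ![1, 1, p13, p13], ![gE c a, gQ b, gQ b, gE c a]⟩,
    ⟨gR c b, 2, ![p13, p13, 1, 1], ![gE c a, gE c a, gE c a, gE c a]⟩,
    ⟨gP a b, 1, ![1, 1, 1, 1], ![gQ c, gmV c, gE a b, gE a b]⟩,
    ⟨gP a c, 1, ![1, 1, p13, p13], ![gQ b, gmV b, gE a b, gE a b]⟩,
    ⟨gP b a, 1, ![1, 1, 1, 1], ![gQ c, gQ c, gE b a, gE b a]⟩,
    ⟨gP b c, 1, ![1, p13, p13, p13], ![gQ a, gE b a, gE b a, gE b a]⟩,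
    ⟨gP c a, 1, ![1, 1, 1, 1], ![gQ b, gQ b, gE c a, gE c a]⟩,
    ⟨gP c b, 1, ![1, p13, p13, p13], ![gQ a, gE c a, gE c a, gE c a]⟩,
    ⟨gS a b, 1, ![p12, p12, 1, 1], ![gE a b, gE a b, gE b a, gE c a]⟩,
    ⟨gC a b, 4, ![p23, 1, p13, p132], ![gE a b, gE a b, gE a b, gE a b]⟩,
    ⟨gXa a b, 1, ![1, 1, 1, 1], ![gQ a, gQ a, gK a b, gK a b]⟩,
    ⟨gX b c, 1, ![1, p13, p13, p13], ![gK a b, gE c a, gE c a, gE c a]⟩,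
    ⟨gX c b, 1, ![p13, p13, p13, p13], ![gK a b, gE b a, gE b a, gE b a]⟩,
    ⟨gYa a b, 4, ![1, 1, 1, 1], ![gK a b, gK a b, gK a b, gK a b]⟩,
    ⟨gY b c, 4, ![1, p132, p23, p13], ![gE c a, gE c a, gE c a, gE c a]⟩,
    ⟨gY c b, 4, ![1, p132, p23, p13], ![gE b a, gE b a, gE b a, gE b a]⟩]

theorem recolour_tri {k : ℕ} (e : Equiv.Perm (Fin 3)) (i j : Fin 3) (β γ : Equiv.Perm (Fin k)) :
    recolour e (tri (e i) (e j) β γ) = tri i j β γ := by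
  funext c
  simp [recolour, tri]

theorem recolour_dbl {k : ℕ} (e : Equiv.Perm (Fin 3)) (i : Fin 3) (β : Equiv.Perm (Fin k)) :
    recolour e (dbl (e i) β) = dbl i β := recolour_tri e i i 1 β

theorem recolour_disj {k l : ℕ} (e : Equiv.Perm (Fin 3)) (B : ColGraph k) (C : ColGraph l) :
    recolour e (disj B C) = disj (recolour e B) (recolour e C) := rfl

theorem recolour_gm (e : Equiv.Perm (Fin 3)) : recolour e gm = gm := rfl

theorem recolour_gEmpty (e : Equiv.Perm (Fin 3)) : recolour e gEmpty = gEmpty := rfl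

theorem recolour_gV (e : Equiv.Perm (Fin 3)) (i : Fin 3) : recolour e (gV (e i)) = gV i :=
  recolour_dbl ..

theorem recolour_gQ (e : Equiv.Perm (Fin 3)) (i : Fin 3) : recolour e (gQ (e i)) = gQ i :=
  recolour_dbl ..

theorem recolour_gE (e : Equiv.Perm (Fin 3)) (i j : Fin 3) :
    recolour e (gE (e i) (e j)) = gE i j := recolour_tri ..

theorem recolour_gK (e : Equiv.Perm (Fin 3)) (i j : Fin 3) :
    recolour e (gK (e i) (e j)) = gK i j := recolour_tri ..

theorem comp_vecCons {α β : Type*} {n : ℕ} (f : α → β) (x : α) (v : Fin n → α) :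
    f ∘ Matrix.vecCons x v = Matrix.vecCons (f x) (f ∘ v) :=
  Fin.comp_cons f x v

theorem comp_vecEmpty {α β : Type*} (f : α → β) (v : Fin 0 → α) : f ∘ v = ![] :=
  Subsingleton.elim _ _

theorem map_recolour_removals0 (e : Equiv.Perm (Fin 3)) :
    removals0.map (Removal.recolour e) = removals0 := by
  simp [removals0, comp_vecCons, comp_vecEmpty, Removal.recolour, recolour_gm, recolour_gEmpty]

theorem map_recolour_removals1 (e : Equiv.Perm (Fin 3)) :
    (removals1 (e 0) (e 1) (e 2)).map (Removal.recolour e) = removals1 0 1 2 := by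
  simp [removals1, comp_vecCons, comp_vecEmpty, Removal.recolour, recolour_disj, recolour_gm, recolour_gV, gmm]

theorem map_recolour_removals2 (e : Equiv.Perm (Fin 3)) :
    (removals2 (e 0) (e 1) (e 2)).map (Removal.recolour e) = removals2 0 1 2 := by
  simp [removals2, comp_vecCons, comp_vecEmpty, Removal.recolour, recolour_disj, recolour_gm, recolour_gV, recolour_gQ,
    recolour_gE, recolour_gK, gmm, gmmm, gmV]

theorem map_recolour_removals3 (e : Equiv.Perm (Fin 3)) :
    (removals3 (e 0) (e 1) (e 2)).map (Removal.recolour e) = removals3 0 1 2 := by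
  simp [removals3, comp_vecCons, comp_vecEmpty, Removal.recolour, recolour_disj, recolour_gm, recolour_gV, recolour_gQ,
    recolour_gE, recolour_gK, recolour_tri, recolour_dbl, gmm, gmmm, gmV, gmmmm, gmmV, gVV, gmQ,
    gmE, gmK, gA, gW, gR, gP, gS, gC, gXa, gX, gYa, gY]

theorem valid_removals0 : ∀ R ∈ removals0, R.Valid := by decide +kernel

theorem valid_removals1 : ∀ R ∈ removals1 0 1 2, R.Valid := by decide +kernel

theorem valid_removals2 : ∀ R ∈ removals2 0 1 2, R.Valid := by decide +kernel

theorem valid_removals3 : ∀ R ∈ removals3 0 1 2, R.Valid := by decide +kernel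

theorem nodup_faceKey_removals1 : ((removals1 0 1 2).map fun R => faceKey R.graph).Nodup := by
  decide +kernel

theorem nodup_faceKey_removals2 : ((removals2 0 1 2).map fun R => faceKey R.graph).Nodup := by
  decide +kernel

theorem nodup_faceKey_removals3 : ((removals3 0 1 2).map fun R => faceKey R.graph).Nodup := by
  decide +kernel

theorem mass_removals1 :
    ((removals1 0 1 2).map fun R => ((R.aut : ℚ))⁻¹).sum = (1 + 1).factorial := by
  norm_num [removals1, Nat.factorial]

theorem mass_removals2 :
    ((removals2 0 1 2).map fun R => ((R.aut : ℚ))⁻¹).sum = (2 + 1).factorial := by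
  norm_num [removals2, Nat.factorial]

theorem mass_removals3 :
    ((removals3 0 1 2).map fun R => ((R.aut : ℚ))⁻¹).sum = (3 + 1).factorial := by
  norm_num [removals3, Nat.factorial]

theorem exists_perm_fin_three {a b c : Fin 3} (hab : a ≠ b) (hac : a ≠ c) (hbc : b ≠ c) :
    ∃ e : Equiv.Perm (Fin 3), e 0 = a ∧ e 1 = b ∧ e 2 = c := by
  have h : Function.Injective ![a, b, c] := by
    intro i j
    fin_cases i <;> fin_cases j <;> simp [hab, hac, hbc, hab.symm, hac.symm, hbc.symm]
  exact ⟨Equiv.ofBijective _ (Finite.injective_iff_bijective.1 h), rfl, rfl, rfl⟩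

end TensorModel

end

theorem mainTheorem3 (I : Fin 3 → Finset ℤ) (E : Mom I → ℝ) (hE : ∀ x, E x ≠ 0)
    (a b c : Fin 3) (hab : a ≠ b) (hac : a ≠ c) (hbc : b ≠ c) (s : I a)
    (m : (Mom I ⊕ Mom I) →₀ ℕ) (hm : m.degree < 8) :
    MvPowerSeries.coeff m (Y E a s) =
      MvPowerSeries.coeff m
        (
          srcPair (D E s 0 gm) gEmpty
        + srcPair ((1 / 2 : ℂ) • (∑ r, D E s r gmm)
              + (1 / 2 : ℂ) • (∑ r, D E s r (gV a))
              + (1 / 2 : ℂ) • (∑ r, D E s r (gV b))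
              + (1 / 2 : ℂ) • (∑ r, D E s r (gV c)))
            gm
        + srcPair ((1 / 3 : ℂ) • (∑ r, D E s r (gQ a))
              + (1 / 3 : ℂ) • (∑ r, D E s r (gK a b))
              + D E s 2 (gE b a)
              + D E s 2 (gE c a)
              + (1 / 2 : ℂ) • (D E s 0 (gmV a)))
            (gV a)
        + srcPair ((1 / 3 : ℂ) • (∑ r, D E s r (gQ b))
              + D E s 2 (gE a b)
              + (∑ r ∈ {0, 1}, D E s r (gE c a))
              + (1 / 2 : ℂ) • (D E s 0 (gmV b)))
            (gV b)
        + srcPair ((1 / 3 : ℂ) • (∑ r, D E s r (gQ c))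
              + D E s 0 (gE a b)
              + (∑ r ∈ {0, 1}, D E s r (gE b a))
              + (1 / 2 : ℂ) • (D E s 0 (gmV c)))
            (gV c)
        + srcPair ((1 / 6 : ℂ) • (∑ r, D E s r gmmm)
              + D E s 1 (gE a b)
              + (1 / 2 : ℂ) • (∑ r ∈ {1, 2}, D E s r (gmV a))
              + (1 / 2 : ℂ) • (∑ r ∈ {1, 2}, D E s r (gmV b))
              + (1 / 2 : ℂ) • (∑ r ∈ {1, 2}, D E s r (gmV c)))
            gmm
        + srcPair ((1 / 4 : ℂ) • (∑ r ∈ {2, 3}, D E s r (gmmV a))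
              + (1 / 4 : ℂ) • (∑ r ∈ {2, 3}, D E s r (gmmV b))
              + (1 / 4 : ℂ) • (∑ r ∈ {2, 3}, D E s r (gmmV c))
              + (1 / 24 : ℂ) • (∑ r, D E s r gmmmm)
              + D E s 2 (gmE a b))
            gmmm
        + srcPair ((1 / 8 : ℂ) • (∑ r ∈ {0, 1}, D E s r (gVV a a))
              + (1 / 8 : ℂ) • (permStar p132 (∑ r ∈ {2, 3}, D E s r (gVV a a)))
              + (1 / 4 : ℂ) • (∑ r ∈ {0, 1}, D E s r (gVV b a))
              + (1 / 4 : ℂ) • (∑ r ∈ {0, 1}, D E s r (gVV c a))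
              + (1 / 3 : ℂ) • (∑ r ∈ {1, 2, 3}, D E s r (gmK a b))
              + (1 / 3 : ℂ) • (∑ r ∈ {1, 2, 3}, D E s r (gmQ a))
              + D E s 3 (gmE c a)
              + D E s 3 (gmE b a)
              + (1 / 4 : ℂ) • (∑ r ∈ {0, 1}, D E s r (gmmV a))
              + D E s 1 (gW b c)
              + permStar p132 (D E s 2 (gW c a)))
            (gmV a)
        + srcPair ((1 / 8 : ℂ) • (∑ r ∈ {0, 1}, D E s r (gVV b b))
              + (1 / 8 : ℂ) • (permStar p132 (∑ r ∈ {2, 3}, D E s r (gVV b b)))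
              + (1 / 4 : ℂ) • (permStar p132 (∑ r ∈ {2, 3}, D E s r (gVV b a)))
              + (1 / 4 : ℂ) • (permStar p132 (∑ r ∈ {2, 3}, D E s r (gVV b c)))
              + (1 / 3 : ℂ) • (∑ r ∈ {1, 2, 3}, D E s r (gmQ b))
              + (∑ r ∈ {1, 2}, D E s r (gmE c a))
              + D E s 3 (gmE a b)
              + (1 / 4 : ℂ) • (∑ r ∈ {0, 1}, D E s r (gmmV b))
              + (1 / 2 : ℂ) • (D E s 1 (gR a c))
              + (1 / 2 : ℂ) • (permStar p132 (D E s 2 (gR a c)))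
              + D E s 1 (gP a c))
            (gmV b)
        + srcPair ((1 / 8 : ℂ) • (∑ r ∈ {0, 1}, D E s r (gVV c c))
              + (1 / 8 : ℂ) • (permStar p132 (∑ r ∈ {2, 3}, D E s r (gVV c c)))
              + (1 / 4 : ℂ) • (permStar p132 (∑ r ∈ {2, 3}, D E s r (gVV c a)))
              + (1 / 4 : ℂ) • (∑ r ∈ {0, 1}, D E s r (gVV b c))
              + (1 / 3 : ℂ) • (∑ r ∈ {1, 2, 3}, D E s r (gmQ c))
              + (∑ r ∈ {1, 2}, D E s r (gmE b a))
              + D E s 1 (gmE a b)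
              + (1 / 4 : ℂ) • (∑ r ∈ {0, 1}, D E s r (gmmV c))
              + (1 / 2 : ℂ) • (D E s 1 (gR a b))
              + (1 / 2 : ℂ) • (permStar p132 (D E s 2 (gR a b)))
              + D E s 1 (gP a b))
            (gmV c)
        + srcPair ((1 / 3 : ℂ) • (D E s 0 (gmK a b))
              + D E s 0 (gX b c)
              + permStar p13 (D E s 0 (gX c b))
              + (∑ r ∈ {2, 3}, D E s r (gXa a b))
              + (1 / 4 : ℂ) • (∑ r, D E s r (gYa a b)))
            (gK a b)
        + srcPair ((1 / 3 : ℂ) • (D E s 0 (gmQ a))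
              + D E s 0 (gP b c)
              + D E s 0 (gP c b)
              + (1 / 4 : ℂ) • (∑ r, D E s r (gA a))
              + (∑ r ∈ {0, 1}, D E s r (gXa a b)))
            (gQ a)
        + srcPair ((1 / 3 : ℂ) • (D E s 0 (gmQ b))
              + (1 / 2 : ℂ) • (D E s 1 (gR c a))
              + (1 / 2 : ℂ) • (permStar p13 (D E s 2 (gR c a)))
              + (1 / 4 : ℂ) • (∑ r, D E s r (gA b))
              + D E s 0 (gP a c)
              + (∑ r ∈ {0, 1}, D E s r (gP c a)))
            (gQ b)
        + srcPair ((1 / 3 : ℂ) • (D E s 0 (gmQ c))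
              + (1 / 2 : ℂ) • (D E s 1 (gR b a))
              + (1 / 2 : ℂ) • (permStar p13 (D E s 2 (gR b a)))
              + (1 / 4 : ℂ) • (∑ r, D E s r (gA c))
              + D E s 0 (gP a b)
              + (∑ r ∈ {0, 1}, D E s r (gP b a)))
            (gQ c)
        + srcPair (D E s 0 (gmE a b)
              + (∑ r ∈ {1, 2}, D E s r (gW a b))
              + permStar p13 (∑ r ∈ {2, 3}, D E s r (gW b c))
              + (∑ r ∈ {2, 3}, D E s r (gP a b))
              + permStar p13 (∑ r ∈ {2, 3}, D E s r (gP a c))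
              + permStar p13 (∑ r ∈ {0, 1}, D E s r (gW c a))
              + (1 / 2 : ℂ) • (D E s 0 (gR a b))
              + (1 / 2 : ℂ) • (permStar p13 (D E s 0 (gR a c)))
              + (1 / 2 : ℂ) • (permStar p13 (D E s 3 (gR a b)))
              + (1 / 2 : ℂ) • (D E s 3 (gR a c))
              + permStar p12 (∑ r ∈ {0, 1}, D E s r (gS a b))
              + (1 / 4 : ℂ) • (permStar p23 (D E s 0 (gC a b)))
              + (1 / 4 : ℂ) • (D E s 1 (gC a b))
              + (1 / 4 : ℂ) • (permStar p13 (D E s 2 (gC a b)))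
              + (1 / 4 : ℂ) • (permStar p132 (D E s 3 (gC a b))))
            (gE a b)
        + srcPair (D E s 0 (gmE b a)
              + D E s 0 (gW a b)
              + D E s 3 (gW c a)
              + (1 / 2 : ℂ) • (permStar p13 (∑ r ∈ {0, 1}, D E s r (gR b c)))
              + (1 / 2 : ℂ) • (∑ r ∈ {2, 3}, D E s r (gR b c))
              + (1 / 2 : ℂ) • (D E s 0 (gR b a))
              + (1 / 2 : ℂ) • (permStar p13 (D E s 3 (gR b a)))
              + (∑ r ∈ {2, 3}, D E s r (gP b a))
              + permStar p13 (∑ r ∈ {1, 2, 3}, D E s r (gP b c))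
              + permStar p13 (∑ r ∈ {1, 2, 3}, D E s r (gX c b))
              + D E s 2 (gS a b)
              + (1 / 4 : ℂ) • (D E s 0 (gY c b))
              + (1 / 4 : ℂ) • (permStar p132 (D E s 1 (gY c b)))
              + (1 / 4 : ℂ) • (permStar p23 (D E s 2 (gY c b)))
              + (1 / 4 : ℂ) • (permStar p13 (D E s 3 (gY c b))))
            (gE b a)
        + srcPair (D E s 0 (gmE c a)
              + permStar p13 (D E s 3 (gW a b))
              + permStar p13 (D E s 0 (gW b c))
              + (1 / 2 : ℂ) • (permStar p13 (∑ r ∈ {0, 1}, D E s r (gR c b)))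
              + (1 / 2 : ℂ) • (∑ r ∈ {2, 3}, D E s r (gR c b))
              + (1 / 2 : ℂ) • (D E s 0 (gR c a))
              + (1 / 2 : ℂ) • (permStar p13 (D E s 3 (gR c a)))
              + (∑ r ∈ {2, 3}, D E s r (gP c a))
              + permStar p13 (∑ r ∈ {1, 2, 3}, D E s r (gP c b))
              + permStar p13 (∑ r ∈ {1, 2, 3}, D E s r (gX b c))
              + D E s 3 (gS a b)
              + (1 / 4 : ℂ) • (D E s 0 (gY b c))
              + (1 / 4 : ℂ) • (permStar p132 (D E s 1 (gY b c)))
              + (1 / 4 : ℂ) • (permStar p23 (D E s 2 (gY b c)))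
              + (1 / 4 : ℂ) • (permStar p13 (D E s 3 (gY b c))))
            (gE c a)) := by
  obtain ⟨e, rfl, rfl, rfl⟩ := exists_perm_fin_three hab hac hbc
  rw [coeff_Y_of_degree_lt E (e 0) s 4 m hm]
  refine congrArg _ ?_
  rw [Finset.sum_range_succ, Finset.sum_range_succ, Finset.sum_range_succ, Finset.sum_range_one,
    Yterm_eq_sum_removals E e s _ _ (map_recolour_removals0 e) valid_removals0
      (List.nodup_singleton _) (by simp [removals0]),
    Yterm_eq_sum_removals E e s _ _ (map_recolour_removals1 e) valid_removals1
      nodup_faceKey_removals1 mass_removals1,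
    Yterm_eq_sum_removals E e s _ _ (map_recolour_removals2 e) valid_removals2
      nodup_faceKey_removals2 mass_removals2,
    Yterm_eq_sum_removals E e s _ _ (map_recolour_removals3 e) valid_removals3
      nodup_faceKey_removals3 mass_removals3]
  -- Both sides become linear combinations of the pairings `srcPair (permStar σ (D E s r B)) T`.
  simp only [removals0, removals1, removals2, removals3, List.map_cons, List.map_nil,
    List.sum_cons, List.sum_nil, Nat.reduceAdd, Fin.sum_univ_one, Fin.sum_univ_two,
    Fin.sum_univ_three, Fin.sum_univ_four, Matrix.cons_val, permStar_one]
  simp only [Finset.sum_insert, Finset.sum_singleton, Finset.mem_insert, Finset.mem_singleton,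
    Fin.reduceEq, or_self, not_false_eq_true, permStar_add, srcPair_add, srcPair_smul]
  push_cast
  module
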